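/- **Theorem 4.1.** Let $m=2k+1$ with $k\ge 1$, and $\mu\in\{1,-1\}$. Let $Z$ be a complex Gaussian random measure on $\mathbb R$, symmetric around the origin ($Z(-\Delta)=\overline{Z(\Delta)}$), with finite control measure $F$, $\mathbb E|Z(d\lambda)|^2=F(d\lambda)$, let $M:\mathbb R\to\mathbb R$ be deterministic, and let $\eta(x)=M(x)+\int_{\mathbb R}e^{i\lambda x}Z(d\lambda)$, $x\in\mathbb R$. Assume that for all $x,y\in\mathbb R$ $$\mathrm{Cov}(\eta(y),\eta(y+x))=\sum_{j=0}^{n}A_j\frac{\cos(w_jx)}{(1+x^2)^{\kappa_j/2}},$$ where $\kappa_j\in(0,1)$, $A_j\in\mathbb R$, $\sum_{j=0}^nA_j=1$, $w_0=0$, $w_j\ne0$ for $j\ge1$, and $A_0=0$. For the equation $\partial_tu=\mu\,\partial_x^mu$, $t>0$, $x\in\mathbb R$, with random initial condition $\eta$, put $u_m(t,x)=\frac1{2\pi}\int_{\mathbb R}e^{-i\lambda x-i\mu(-1)^{(m-1)/2}t\lambda^m}d\lambda$ (improper integral), and let $u(t,x)$ be the random field, measurable in $(x,\omega)$ for each $t>0$,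 with $$u(t,x)=\int_{\mathbb R}M(x-y)\,u_m(t,y)\,dy+\frac1{2\pi}\int_{\mathbb R}e^{i\lambda x+i\mu(-1)^{(m-1)/2}\lambda^mt}Z(d\lambda)\quad\text{a.s.},\qquad t>0,\ x\in\mathbb R$$ (note the normalization $\frac1{2\pi}$ of the random part). It is assumed that the first integral, $D(t,x)$, exists (as $\lim_{R\to\infty}\int_{-R}^R$) and that $x_1\mapsto e^{-(x_1-x)^2}D(t,x_1/\sqrt\varepsilon)$ is integrable for all $t,\varepsilon>0$, $x\in\mathbb R$. With $g(x_1,x)=e^{-(x_1-x)^2}$ let, for $\varepsilon>0$, $$\overline U^g_\varepsilon(t,x)=\varepsilon^{-1/4}\left[\int_{\mathbb R}g(x_1,x)\,u\Big(\frac t{\sqrt{\varepsilon^m}},\frac{x_1}{\sqrt\varepsilon}\Big)dx_1-\mathbb E\int_{\mathbb R}g(x_1,x)\,u\Big(\frac t{\sqrt{\varepsilon^m}},\frac{x_1}{\sqrt\varepsilon}\Big)dx_1\right].$$ Then, as $\varepsilon\to0^+$, the finite-dimensional distributions of $\overline U^g_\varepsilon(t,x)$, $t>0$, $x\in\mathbb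 R$, converge weakly to those of the zero-mean Gaussian random field $$U^g_0(t,x)=\frac1{2\sqrt\pi}\sqrt{\sum_{j=1}^nc_1(\kappa_j)A_jK_{\frac{\kappa_j-1}2}(|w_j|)|w_j|^{\frac{\kappa_j-1}2}}\int_{\mathbb R}e^{i(\lambda x+\mu(-1)^{(m-1)/2}\lambda^mt)}e^{-\lambda^2/4}\,W(d\lambda),$$ where $W$ is complex Gaussian white noise on $\mathbb R$ (control measure $d\lambda$), symmetric around the origin, $c_1(\kappa)=2^{(1-\kappa)/2}/(\sqrt\pi\,\Gamma(\kappa/2))$, and $K_\nu(z)=\frac12\int_0^\infty s^{\nu-1}e^{-\frac12(s+\frac1s)z}ds$, $z>0$. The covariance function of the limit is $$\mathrm{Cov}(U^g_0(t,x),U^g_0(t',x'))=\sum_{j=1}^n\frac{c_1(\kappa_j)A_jK_{\frac{\kappa_j-1}2}(|w_j|)}{4\pi|w_j|^{\frac{1-\kappa_j}2}}\int_{\mathbb R}\cos\big(\lambda(x-x')+\mu(-1)^{(m-1)/2}(t-t')\lambda^m\big)e^{-\lambda^2/2}d\lambda,$$ and $U^g_0$ is stationary in space and time: its finite-dimensional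 distributions are invariant under shifts $(t,x)\mapsto(t+h,x+y)$ that keep all times positive. -/

import Mathlib

open MeasureTheory ProbabilityTheory Filter Topology
open scoped ComplexConjugate ENNReal

noncomputable section

/-! ### Symmetric complex Gaussian random measures and stochastic integrals -/

/-- `Z` is a symmetric (Hermitian) complex Gaussian random measure on `ℝ` with control measure `F`,
i.e. `E |Z(dv)|² = F(dv)` and `Z(-A) = conj Z(A)`. Only the values of `Z` on Borel sets of
finite `F`-measure are relevant. Complex white noise is the case `F = volume`. -/
structure IsSymmGaussianRandomMeasure {Ω : Type*} [MeasurableSpace Ω] (P : Measure Ω)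
    (F : Measure ℝ) (Z : Set ℝ → Ω → ℂ) : Prop where
  /-- The values are jointly Gaussian (`ℂ` being regarded as a real plane). -/
  gaussian : IsGaussianProcess
    (fun (A : {A : Set ℝ // MeasurableSet A ∧ F A ≠ ∞}) (ω : Ω) => Z A.1 ω) P
  mean_zero : ∀ A, MeasurableSet A → F A ≠ ∞ → ∫ ω, Z A ω ∂P = 0
  orthogonal : ∀ A B, MeasurableSet A → F A ≠ ∞ → MeasurableSet B → F B ≠ ∞ →
    ∫ ω, Z A ω * conj (Z B ω) ∂P = ((F (A ∩ B)).toReal : ℂ)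
  additive : ∀ A B, MeasurableSet A → F A ≠ ∞ → MeasurableSet B → F B ≠ ∞ → Disjoint A B →
    Z (A ∪ B) =ᵐ[P] fun ω => Z A ω + Z B ω
  symm : ∀ A, MeasurableSet A → F A ≠ ∞ → F ((fun v => -v) ⁻¹' A) ≠ ∞ ∧
    Z ((fun v => -v) ⁻¹' A) =ᵐ[P] fun ω => conj (Z A ω)

/-- The integral `∑ c Z{s = c}` of a simple function against `Z`. -/
def simpleStochInt {Ω : Type*} (Z : Set ℝ → Ω → ℂ) (s : SimpleFunc ℝ ℂ) (ω : Ω) : ℂ :=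
  ∑ c ∈ s.range, c * Z (s ⁻¹' {c}) ω

/-- `X` is (a version of) the stochastic integral `∫ φ(v) Z(dv)`: the `L²(P)`-limit of the
integrals of simple functions that converge to `φ` in `L²(F)`. -/
def IsStochInt {Ω : Type*} [MeasurableSpace Ω] (P : Measure Ω) (F : Measure ℝ)
    (Z : Set ℝ → Ω → ℂ) (φ : ℝ → ℂ) (X : Ω → ℂ) : Prop :=
  MemLp X 2 P ∧ ∃ s : ℕ → SimpleFunc ℝ ℂ, (∀ i, MemLp (s i) 2 F) ∧
    Tendsto (fun i => eLpNorm (fun v => φ v - s i v) 2 F) atTop (𝓝 0) ∧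
    Tendsto (fun i => eLpNorm (fun ω => X ω - simpleStochInt Z (s i) ω) 2 P) atTop (𝓝 0)

open Classical in
/-- The stochastic integral `∫ φ(v) Z(dv)`, determined up to `P`-null sets. -/
def stochInt {Ω : Type*} [MeasurableSpace Ω] (P : Measure Ω) (F : Measure ℝ)
    (Z : Set ℝ → Ω → ℂ) (φ : ℝ → ℂ) : Ω → ℂ :=
  if h : ∃ X, IsStochInt P F Z φ X then h.choose else 0

/-! ### The initial condition -/

/-- The covariance function `r(x) = ∑_{j=0}^n A_j cos(w_j x) / (1 + x²)^{κ_j/2}`. -/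
def cyclicCov {n : ℕ} (A κ w : Fin (n + 1) → ℝ) (x : ℝ) : ℝ :=
  ∑ j, Real.cos (w j * x) / (1 + x ^ 2) ^ (κ j / 2) * A j

/-- The process `η` has the (cyclic long-range dependent) covariance function `cyclicCov A κ w`,
with the standing restrictions on the parameters. -/
structure HasCyclicCov {Ω : Type*} [MeasurableSpace Ω] (P : Measure Ω) (η : ℝ → Ω → ℝ)
    {n : ℕ} (A κ w : Fin (n + 1) → ℝ) : Prop where
  sum_eq_one : ∑ j, A j = 1
  w_zero : w 0 = 0
  w_ne_zero : ∀ j, j ≠ 0 → w j ≠ 0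
  κ_mem : ∀ j, κ j ∈ Set.Ioo (0 : ℝ) 1
  cov_eq : ∀ y x, cov[η y, η (y + x); P] = cyclicCov A κ w x

/-- The initial condition `η(x) = M(x) + ∫ e^{ivx} Z(dv)`. -/
def IsInitialCondition {Ω : Type*} [MeasurableSpace Ω] (P : Measure Ω) (F : Measure ℝ)
    (Z : Set ℝ → Ω → ℂ) (M : ℝ → ℝ) (η : ℝ → Ω → ℝ) : Prop :=
  ∀ x, (fun ω => (η x ω : ℂ)) =ᵐ[P] fun ω =>
    (M x : ℂ) + stochInt P F Z (fun v => Complex.exp (Complex.I * (v * x : ℝ))) ω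

/-! ### The solution field of `∂ₜ u = μ ∂ₓᵐ u`, `m` odd -/

/-- The phase `v x + μ (-1)^{(m-1)/2} vᵐ t`. -/
def phase (μ : ℝ) (m : ℕ) (t x v : ℝ) : ℝ :=
  v * x + μ * (-1) ^ ((m - 1) / 2) * v ^ m * t

/-- `I` is the improper integral `lim_{R → ∞} ∫_{-R}^R f`. -/
def HasImproperIntegral (f : ℝ → ℝ) (I : ℝ) : Prop :=
  (∀ a b, IntervalIntegrable f volume a b) ∧
    Tendsto (fun R : ℝ => ∫ y in (-R)..R, f y) atTop (𝓝 I)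

/-- The fundamental solution
`u_m(t,x) = (2π)⁻¹ ∫ exp(-ivx - iμ(-1)^{(m-1)/2} t vᵐ) dv`. The integral is a (conditionally
convergent) improper one; the sine part is odd in `v` and drops out. -/
def fundSol (μ : ℝ) (m : ℕ) (t x : ℝ) : ℝ :=
  limUnder atTop (fun R : ℝ => (2 * Real.pi)⁻¹ * ∫ v in (-R)..R, Real.cos (phase μ m t x v))

/-- `u` is the solution random field: it is measurable in `(x, ω)` and for all `t > 0` and `x`
almost surely
`u(t,x) = ∫ M(x-y) u_m(t,y) dy + (2π)⁻¹ ∫ exp(i(vx + μ(-1)^{(m-1)/2} vᵐ t)) Z(dv)`.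
The deterministic part is called `D`. -/
structure IsSolutionField {Ω : Type*} [MeasurableSpace Ω] (P : Measure Ω) (F : Measure ℝ)
    (Z : Set ℝ → Ω → ℂ) (M : ℝ → ℝ) (μ : ℝ) (m : ℕ) (D : ℝ → ℝ → ℝ)
    (u : ℝ → ℝ → Ω → ℝ) : Prop where
  measurable : ∀ t, 0 < t → Measurable (fun p : ℝ × Ω => u t p.1 p.2)
  mean_part : ∀ t, 0 < t → ∀ x,
    HasImproperIntegral (fun y => M (x - y) * fundSol μ m t y) (D t x)
  eq : ∀ t, 0 < t → ∀ x, (fun ω => (u t x ω : ℂ)) =ᵐ[P] fun ω =>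
    (D t x : ℂ) + (2 * Real.pi : ℂ)⁻¹ *
      stochInt P F Z (fun v => Complex.exp (Complex.I * (phase μ m t x v : ℝ))) ω

/-! ### Smoothing and the limit field -/

/-- The Gaussian-type kernel. -/
def gaussKernel (x₁ x : ℝ) : ℝ := Real.exp (-(x₁ - x) ^ 2)

/-- The spatially averaged, rescaled and centred field
`ε^{-1/4} (∫ g(x₁,x) u(t/√(εᵐ), x₁/√ε) dx₁ - E ∫ g(x₁,x) u(t/√(εᵐ), x₁/√ε) dx₁)`. -/
def smoothedField {Ω : Type*} [MeasurableSpace Ω] (P : Measure Ω) (m : ℕ)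
    (u : ℝ → ℝ → Ω → ℝ) (ε t x : ℝ) (ω : Ω) : ℝ :=
  ε ^ (-(1 / 4) : ℝ) *
    ((∫ x₁, gaussKernel x₁ x * u (t / √(ε ^ m)) (x₁ / √ε) ω) -
      ∫ ω', (∫ x₁, gaussKernel x₁ x * u (t / √(ε ^ m)) (x₁ / √ε) ω') ∂P)

/-- The modified Bessel function of the second kind `K_ν(z)`, `z > 0`. -/
def besselK (ν z : ℝ) : ℝ :=
  (1 / 2) * ∫ s in Set.Ioi (0 : ℝ), s ^ (ν - 1) * Real.exp (-(1 / 2) * (s + 1 / s) * z)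

/-- `c₁(κ) = 2^{(1-κ)/2} / (√π Γ(κ/2))`. -/
def c₁ (κ : ℝ) : ℝ := 2 ^ ((1 - κ) / 2) / (√Real.pi * Real.Gamma (κ / 2))

/-- `∑_{j=1}^n c₁(κ_j) A_j K_{(κ_j-1)/2}(|w_j|) |w_j|^{(κ_j-1)/2}`, the value at frequency zero
of the spectral density when `A_0 = 0`. -/
def specConst {n : ℕ} (A κ w : Fin (n + 1) → ℝ) : ℝ :=
  ∑ j : Fin n, c₁ (κ j.succ) * A j.succ * besselK ((κ j.succ - 1) / 2) |w j.succ| *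
    |w j.succ| ^ ((κ j.succ - 1) / 2)

/-- `U₀` is the random field
`U₀(t,x) = (2√π)⁻¹ √C ∫ exp(i(vx + μ(-1)^{(m-1)/2} vᵐ t)) exp(-v²/4) W(dv)`, `t > 0`. -/
def IsLimitField {Ω : Type*} [MeasurableSpace Ω] (P : Measure Ω) (W : Set ℝ → Ω → ℂ)
    (C μ : ℝ) (m : ℕ) (U₀ : ℝ → ℝ → Ω → ℝ) : Prop :=
  ∀ t, 0 < t → ∀ x, (fun ω => (U₀ t x ω : ℂ)) =ᵐ[P] fun ω =>
    ((1 / (2 * √Real.pi) * √C : ℝ) : ℂ) *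
      stochInt P volume W (fun v => Complex.exp (Complex.I * (phase μ m t x v : ℝ)) *
        Complex.exp (-(v : ℂ) ^ 2 / 4)) ω

end

/-! All the random variables involved lie in a Gaussian Hilbert space: the closed span in `L²` of
the real and imaginary parts of the values of the random measure. Its elements have mean zero and
characteristic function `exp (-‖f‖² / 2)` (`integral_exp_of_mem_closure`), so finite families in it
are centred Gaussian vectors whose laws depend only on second moments. Weak convergence and
stationarity thus become statements about covariances
(`tendstoInDistribution_of_tendsto_integral_mul`, `map_eq_of_integral_mul_eq`).

The prelimit covariance is explicit. By the Itô isometry, Fubini and the Fourier transform of the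
Gaussian kernel, with `c = ε^(-1/2)`, it is `(4π)⁻¹ ∫ c exp(-(cv)²/2) cos(phase(cv)) F(dv)`
(`integral_smoothedField_mul`): the integral of an oscillating kernel that concentrates at frequency
zero.

It remains to know `F` near zero. The function `(1 + x²)^(-κ/2)` is a Gamma mixture of Gaussian
characteristic functions, so it has an explicit spectral density, which away from the origin is a
Bessel function (`maternDensity_eq`). Shifting by `±w_j` and summing gives a density with the same
Fourier transform as `F`, hence the density of `F` (`integral_eq_of_charFun_density`). Its possible
singularities sit at `±w_j`; since `A 0 = 0`, it is continuous at zero, with value `specConst`. The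
approximate identity `tendsto_integral_gaussian_cos` then yields `specConst` times a Gaussian cosine
integral, which the isometry for `W` identifies as the covariance of the limit field. That
covariance involves only differences of times and positions, whence stationarity. -/

/-! ### The Gaussian Hilbert space of a random measure. -/

/-- The span in `L²(P)` of the real and imaginary parts of the values of `Z`. -/
def gaussianSpan {Ω : Type*} [MeasurableSpace Ω] (P : Measure Ω) (F : Measure ℝ)
    (Z : Set ℝ → Ω → ℂ) : Submodule ℝ (Lp ℝ 2 P) :=
  Submodule.span ℝ {f | ∃ A, MeasurableSet A ∧ F A ≠ ∞ ∧
    (f =ᵐ[P] (fun ω => (Z A ω).re) ∨ f =ᵐ[P] (fun ω => (Z A ω).im))}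

/-- `X` is square integrable and belongs to the Gaussian Hilbert space generated by `Z`. -/
def MemGaussianSpace {Ω : Type*} [MeasurableSpace Ω] (P : Measure Ω) (F : Measure ℝ)
    (Z : Set ℝ → Ω → ℂ) (X : Ω → ℝ) : Prop :=
  ∃ h : MemLp X 2 P, h.toLp X ∈ (gaussianSpan P F Z).topologicalClosure

section GaussianSpace

variable {Ω : Type*} [MeasurableSpace Ω] {P : Measure Ω}
  {F : Measure ℝ} {Z : Set ℝ → Ω → ℂ}

/-- Joint Gaussianity of `Z` concerns finite subfamilies. Induction over the span finds one for each
element, a sum using the union of the two index sets. -/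
theorem exists_linear_of_mem_gaussianSpan {f : Lp ℝ 2 P} (hf : f ∈ gaussianSpan P F Z) :
    ∃ (I : Finset {A : Set ℝ // MeasurableSet A ∧ F A ≠ ∞}) (L : (I → ℂ) →L[ℝ] ℝ),
      f =ᵐ[P] fun ω => L (I.restrict (fun A => Z A.1 ω)) := by
  classical
  refine Submodule.span_induction ?_ ?_ ?_ ?_ hf
  · rintro f ⟨A, hA, hFA, h | h⟩
    · refine ⟨{⟨A, hA, hFA⟩}, Complex.reCLM.comp (ContinuousLinearMap.proj ⟨⟨A, hA, hFA⟩, by simp⟩),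
        ?_⟩
      filter_upwards [h] with ω hω
      simp [hω]
    · refine ⟨{⟨A, hA, hFA⟩}, Complex.imCLM.comp (ContinuousLinearMap.proj ⟨⟨A, hA, hFA⟩, by simp⟩),
        ?_⟩
      filter_upwards [h] with ω hω
      simp [hω]
  · refine ⟨∅, 0, ?_⟩
    filter_upwards [Lp.coeFn_zero ℝ 2 P] with ω hω using hω
  · rintro f g - - ⟨I, L, hL⟩ ⟨J, M, hM⟩
    refine ⟨I ∪ J,
      L.comp (ContinuousLinearMap.pi fun i => ContinuousLinearMap.proj
        ⟨i.1, Finset.mem_union_left _ i.2⟩) +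
      M.comp (ContinuousLinearMap.pi fun i => ContinuousLinearMap.proj
        ⟨i.1, Finset.mem_union_right _ i.2⟩), ?_⟩
    filter_upwards [hL, hM, Lp.coeFn_add f g] with ω h1 h2 h3
    rw [h3, Pi.add_apply, h1, h2]
    rfl
  · rintro c f - ⟨I, L, hL⟩
    refine ⟨I, c • L, ?_⟩
    filter_upwards [hL, Lp.coeFn_smul c f] with ω h1 h2
    rw [h2, Pi.smul_apply, h1]
    rfl

theorem hasGaussianLaw_of_mem_gaussianSpan (hZ : IsSymmGaussianRandomMeasure P F Z)
    {f : Lp ℝ 2 P} (hf : f ∈ gaussianSpan P F Z) : HasGaussianLaw f P := by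
  obtain ⟨I, L, hL⟩ := exists_linear_of_mem_gaussianSpan hf
  exact ((hZ.gaussian.hasGaussianLaw I).map_fun L).congr hL.symm

theorem memLp_randomMeasure (hZ : IsSymmGaussianRandomMeasure P F Z) {A : Set ℝ}
    (hA : MeasurableSet A) (hFA : F A ≠ ∞) : MemLp (Z A) 2 P :=
  (hZ.gaussian.hasGaussianLaw_eval ⟨A, hA, hFA⟩).memLp_two

variable [IsProbabilityMeasure P]

theorem lipschitzWith_integral_Lp_two : LipschitzWith 1 (fun f : Lp ℝ 2 P => ∫ ω, f ω ∂P) := by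
  refine LipschitzWith.of_dist_le_mul fun f g => ?_
  have hf := (Lp.memLp f).integrable (by norm_num)
  have hg := (Lp.memLp g).integrable (by norm_num)
  rw [dist_eq_norm, ← integral_sub hf hg, NNReal.coe_one, one_mul]
  refine (norm_integral_le_integral_norm _).trans ?_
  rw [Lp.dist_def]
  have h := eLpNorm_le_eLpNorm_of_exponent_le (μ := P) (p := 1) (q := 2) (by norm_num)
    (hf.aestronglyMeasurable.sub hg.aestronglyMeasurable)
  change ∫ ω, ‖(⇑f - ⇑g) ω‖ ∂P ≤ _
  rw [integral_norm_eq_lintegral_enorm (hf.aestronglyMeasurable.sub hg.aestronglyMeasurable),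
    ← eLpNorm_one_eq_lintegral_enorm]
  exact ENNReal.toReal_mono ((Lp.memLp f).sub (Lp.memLp g)).2.ne h

/-- Follows from `|exp(ia) - exp(ib)| ≤ |a - b|` and the domination of the `L¹` norm by the `L²`
norm under a probability measure. This continuity carries the Gaussian characteristic function from
the span to its closure. -/
theorem lipschitzWith_integral_exp_Lp_two :
    LipschitzWith 1 (fun f : Lp ℝ 2 P => ∫ ω, Complex.exp (Complex.I * (f ω : ℝ)) ∂P) := by
  refine LipschitzWith.of_dist_le_mul fun f g => ?_
  have hfm := (Lp.memLp f).aestronglyMeasurable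
  have hgm := (Lp.memLp g).aestronglyMeasurable
  have hf := (Lp.memLp f).integrable (by norm_num)
  have hg := (Lp.memLp g).integrable (by norm_num)
  have key : ∀ f : Lp ℝ 2 P, Integrable (fun ω => Complex.exp (Complex.I * (f ω : ℝ))) P := by
    intro f
    refine Integrable.of_bound (C := 1) ?_ (ae_of_all _ fun ω => ?_)
    · exact (by fun_prop : Continuous fun x : ℝ => Complex.exp (Complex.I * (x : ℝ)))
        |>.comp_aestronglyMeasurable (Lp.memLp f).aestronglyMeasurable
    · rw [mul_comm, Complex.norm_exp_ofReal_mul_I]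
  rw [dist_eq_norm, ← integral_sub (key f) (key g), NNReal.coe_one, one_mul]
  refine (norm_integral_le_integral_norm _).trans ?_
  refine (integral_mono ((key f).sub (key g)).norm (hf.sub hg).norm fun ω => ?_).trans ?_
  · have e : Complex.exp (Complex.I * (f ω : ℝ)) - Complex.exp (Complex.I * (g ω : ℝ)) =
        Complex.exp ((g ω : ℝ) * Complex.I) *
          (Complex.exp (Complex.I * ((f ω - g ω : ℝ) : ℂ)) - 1) := by
      rw [mul_sub, ← Complex.exp_add]
      push_cast
      ring_nf
    simp only [Pi.sub_apply]
    rw [e, norm_mul, Complex.norm_exp_ofReal_mul_I, one_mul]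
    exact Real.norm_exp_I_mul_ofReal_sub_one_le
  · rw [Lp.dist_def]
    have h := eLpNorm_le_eLpNorm_of_exponent_le (μ := P) (p := 1) (q := 2) (by norm_num)
      (hfm.sub hgm)
    change ∫ ω, ‖(⇑f - ⇑g) ω‖ ∂P ≤ _
    rw [integral_norm_eq_lintegral_enorm (hfm.sub hgm), ← eLpNorm_one_eq_lintegral_enorm]
    exact ENNReal.toReal_mono ((Lp.memLp f).sub (Lp.memLp g)).2.ne h

omit [IsProbabilityMeasure P] in
theorem integral_sq_eq_norm_sq (f : Lp ℝ 2 P) : ∫ ω, f ω ^ 2 ∂P = ‖f‖ ^ 2 := by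
  rw [← real_inner_self_eq_norm_sq, L2.inner_def]
  simp [pow_two]

theorem integral_eq_zero_of_mem_gaussianSpan (hZ : IsSymmGaussianRandomMeasure P F Z)
    {f : Lp ℝ 2 P} (hf : f ∈ gaussianSpan P F Z) : ∫ ω, f ω ∂P = 0 := by
  refine Submodule.span_induction ?_ ?_ ?_ ?_ hf
  · rintro f ⟨A, hA, hFA, h⟩
    have h0 := hZ.mean_zero A hA hFA
    have hi : Integrable (Z A) P := (memLp_randomMeasure hZ hA hFA).integrable (by norm_num)
    rcases h with h | h
    · rw [integral_congr_ae h]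
      have := integral_re hi
      simp_all
    · rw [integral_congr_ae h]
      have := integral_im hi
      simp_all
  · rw [integral_congr_ae (Lp.coeFn_zero ℝ 2 P)]
    simp
  · rintro f g - - h1 h2
    rw [integral_congr_ae (Lp.coeFn_add f g)]
    simp only [Pi.add_apply]
    rw [integral_add ((Lp.memLp f).integrable (by norm_num))
      ((Lp.memLp g).integrable (by norm_num)), h1, h2, add_zero]
  · rintro c f - h1
    rw [integral_congr_ae (Lp.coeFn_smul c f)]
    simp only [Pi.smul_apply]
    rw [integral_smul, h1, smul_zero]

theorem integral_eq_zero_of_mem_closure (hZ : IsSymmGaussianRandomMeasure P F Z)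
    {f : Lp ℝ 2 P} (hf : f ∈ (gaussianSpan P F Z).topologicalClosure) : ∫ ω, f ω ∂P = 0 := by
  have hc : IsClosed {f : Lp ℝ 2 P | ∫ ω, f ω ∂P = 0} :=
    isClosed_eq lipschitzWith_integral_Lp_two.continuous continuous_const
  exact closure_minimal (fun f hf => integral_eq_zero_of_mem_gaussianSpan hZ hf) hc hf

/-- Both sides are `L²`-continuous in `f`, so it suffices to check the span. There `f` is Gaussian
with mean zero, its variance is `‖f‖²`, and the claim is its characteristic function at `1`. -/
theorem integral_exp_of_mem_closure (hZ : IsSymmGaussianRandomMeasure P F Z)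
    {f : Lp ℝ 2 P} (hf : f ∈ (gaussianSpan P F Z).topologicalClosure) :
    ∫ ω, Complex.exp (Complex.I * (f ω : ℝ)) ∂P = Complex.exp (-((‖f‖ ^ 2 / 2 : ℝ) : ℂ)) := by
  have hc : IsClosed {f : Lp ℝ 2 P | ∫ ω, Complex.exp (Complex.I * (f ω : ℝ)) ∂P =
      Complex.exp (-((‖f‖ ^ 2 / 2 : ℝ) : ℂ))} :=
    isClosed_eq lipschitzWith_integral_exp_Lp_two.continuous (by fun_prop)
  refine closure_minimal (fun f hf => ?_) hc hf
  have hG := hasGaussianLaw_of_mem_gaussianSpan hZ hf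
  have h0 := integral_eq_zero_of_mem_gaussianSpan hZ hf
  have h1 := hG.charFun_map_eq 1
  rw [charFun_apply, integral_map hG.aemeasurable (by fun_prop)] at h1
  have hv : Var[fun ω => inner ℝ 1 (f ω); P] = ‖f‖ ^ 2 := by
    rw [variance_of_integral_eq_zero]
    · simp [← integral_sq_eq_norm_sq]
    · simpa using hG.aemeasurable
    · simpa using h0
  rw [hv] at h1
  simp only [RCLike.inner_apply, conj_trivial, one_mul, mul_one, h0] at h1
  rw [Set.mem_ofPred_eq]
  convert h1 using 2
  · simp [mul_comm]
  · push_cast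
    ring

theorem dual_apply_eq_sum {ι : Type*} [Fintype ι] [DecidableEq ι] (L : StrongDual ℝ (ι → ℝ))
    (x : ι → ℝ) : L x = ∑ i, L (Pi.single i 1) * x i := by
  rw [← ContinuousLinearMap.coe_coe, LinearMap.pi_apply_eq_sum_univ]
  refine Finset.sum_congr rfl fun i _ => ?_
  rw [smul_eq_mul, mul_comm]
  congr 2
  ext j
  simp [Pi.single_apply, eq_comm]

namespace MemGaussianSpace

omit [IsProbabilityMeasure P] in
theorem memLp {X : Ω → ℝ} (h : MemGaussianSpace P F Z X) : MemLp X 2 P := h.1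

omit [IsProbabilityMeasure P] in
theorem congr {X Y : Ω → ℝ} (h : MemGaussianSpace P F Z X) (hXY : X =ᵐ[P] Y) :
    MemGaussianSpace P F Z Y := by
  obtain ⟨h1, h2⟩ := h
  refine ⟨h1.ae_eq hXY, ?_⟩
  rwa [← MemLp.toLp_congr h1 (h1.ae_eq hXY) hXY]

omit [IsProbabilityMeasure P] in
theorem add {X Y : Ω → ℝ} (hX : MemGaussianSpace P F Z X) (hY : MemGaussianSpace P F Z Y) :
    MemGaussianSpace P F Z (fun ω => X ω + Y ω) :=
  ⟨hX.1.add hY.1, by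
    have := Submodule.add_mem _ hX.2 hY.2
    rwa [← MemLp.toLp_add] at this⟩

omit [IsProbabilityMeasure P] in
theorem const_mul {X : Ω → ℝ} (c : ℝ) (hX : MemGaussianSpace P F Z X) :
    MemGaussianSpace P F Z (fun ω => c * X ω) :=
  ⟨hX.1.const_mul c, by
    have := Submodule.smul_mem _ c hX.2
    rwa [← MemLp.toLp_const_smul] at this⟩

omit [IsProbabilityMeasure P] in
theorem zero : MemGaussianSpace P F Z (fun _ => 0) :=
  ⟨MemLp.zero, Submodule.zero_mem _⟩

omit [IsProbabilityMeasure P] in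
theorem sum {ι : Type*} (s : Finset ι) {X : ι → Ω → ℝ}
    (hX : ∀ i ∈ s, MemGaussianSpace P F Z (X i)) :
    MemGaussianSpace P F Z (fun ω => ∑ i ∈ s, X i ω) := by
  classical
  induction s using Finset.induction_on with
  | empty => simpa using zero
  | insert a s ha ih =>
    simp only [Finset.sum_insert ha]
    exact (hX a (by simp)).add (ih fun i hi => hX i (by simp [hi]))

theorem integral_eq_zero (hZ : IsSymmGaussianRandomMeasure P F Z) {X : Ω → ℝ}
    (hX : MemGaussianSpace P F Z X) : ∫ ω, X ω ∂P = 0 := by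
  rw [← integral_congr_ae hX.1.coeFn_toLp]
  exact integral_eq_zero_of_mem_closure hZ hX.2

theorem integral_exp (hZ : IsSymmGaussianRandomMeasure P F Z) {X : Ω → ℝ}
    (hX : MemGaussianSpace P F Z X) :
    ∫ ω, Complex.exp (Complex.I * (X ω : ℝ)) ∂P =
      Complex.exp (-(((∫ ω, X ω ^ 2 ∂P) / 2 : ℝ) : ℂ)) := by
  have h := integral_exp_of_mem_closure hZ hX.2
  rw [← integral_sq_eq_norm_sq, integral_congr_ae (g := fun ω => X ω ^ 2)] at h
  · rw [← h]
    refine integral_congr_ae ?_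
    filter_upwards [hX.1.coeFn_toLp] with ω hω
    rw [hω]
  · filter_upwards [hX.1.coeFn_toLp] with ω hω
    rw [hω]

theorem covariance_eq (hZ : IsSymmGaussianRandomMeasure P F Z) {X Y : Ω → ℝ}
    (hX : MemGaussianSpace P F Z X) (hY : MemGaussianSpace P F Z Y) :
    cov[X, Y; P] = ∫ ω, X ω * Y ω ∂P := by
  rw [covariance_eq_sub hX.1 hY.1, hX.integral_eq_zero hZ, hY.integral_eq_zero hZ]
  simp

variable {ι : Type*} [Fintype ι]

omit [IsProbabilityMeasure P] in
theorem dual [DecidableEq ι] {X : ι → Ω → ℝ} (hX : ∀ i, MemGaussianSpace P F Z (X i))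
    (L : StrongDual ℝ (ι → ℝ)) : MemGaussianSpace P F Z (fun ω => L (fun i => X i ω)) := by
  simp only [fun ω => dual_apply_eq_sum L fun i => X i ω]
  exact sum _ fun i _ => (hX i).const_mul _

/-- A finite family in the Gaussian space is a centred Gaussian vector. -/
theorem charFunDual_map [DecidableEq ι] (hZ : IsSymmGaussianRandomMeasure P F Z) {X : ι → Ω → ℝ}
    (hX : ∀ i, MemGaussianSpace P F Z (X i)) (L : StrongDual ℝ (ι → ℝ)) :
    charFunDual (P.map (fun ω i => X i ω)) L =
      Complex.exp (-((∑ i, ∑ j, L (Pi.single i 1) * L (Pi.single j 1) *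
        ∫ ω, X i ω * X j ω ∂P : ℝ) : ℂ) / 2) := by
  have hm : AEMeasurable (fun ω i => X i ω) P :=
    aemeasurable_pi_lambda _ fun i => (hX i).1.aestronglyMeasurable.aemeasurable
  rw [charFunDual_apply, integral_map hm (by fun_prop)]
  have h := (dual hX L).integral_exp hZ
  simp only [mul_comm _ Complex.I]
  rw [h]
  have hi : ∀ i j, Integrable (fun ω => X i ω * X j ω) P := fun i j =>
    (hX i).1.integrable_mul (hX j).1
  have e : ∫ ω, (L fun i => X i ω) ^ 2 ∂P = ∑ i, ∑ j, L (Pi.single i 1) * L (Pi.single j 1) *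
        ∫ ω, X i ω * X j ω ∂P := by
    have : ∀ ω, (L fun i => X i ω) ^ 2 = ∑ i, ∑ j, L (Pi.single i 1) * L (Pi.single j 1) *
        (X i ω * X j ω) := by
      intro ω
      rw [dual_apply_eq_sum, pow_two, Finset.sum_mul_sum]
      refine Finset.sum_congr rfl fun i _ => Finset.sum_congr rfl fun j _ => by ring
    simp only [this]
    rw [integral_finsetSum _ fun i _ => integrable_finsetSum _ fun j _ => (hi i j).const_mul _]
    refine Finset.sum_congr rfl fun i _ => ?_
    rw [integral_finsetSum _ fun j _ => (hi i j).const_mul _]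
    refine Finset.sum_congr rfl fun j _ => ?_
    rw [integral_const_mul]
  rw [e]
  push_cast
  ring_nf

/-- Every linear functional of the vector stays in the Gaussian space, so the scalar characteristic
function decides. -/
theorem hasGaussianLaw_pi [DecidableEq ι] (hZ : IsSymmGaussianRandomMeasure P F Z)
    {X : ι → Ω → ℝ} (hX : ∀ i, MemGaussianSpace P F Z (X i)) :
    HasGaussianLaw (fun ω i => X i ω) P := by
  have hm : AEMeasurable (fun ω i => X i ω) P :=
    aemeasurable_pi_lambda _ fun i => (hX i).1.aestronglyMeasurable.aemeasurable
  rw [hasGaussianLaw_iff_charFunDual_map_eq hm]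
  intro L
  have hd := dual hX L
  have h := hd.integral_exp hZ
  have h0 := hd.integral_eq_zero hZ
  rw [charFunDual_apply, integral_map hm (by fun_prop)]
  simp only [mul_comm _ Complex.I, Function.comp_def]
  rw [h, h0, variance_of_integral_eq_zero hd.1.aestronglyMeasurable.aemeasurable h0]
  simp

end MemGaussianSpace

end GaussianSpace

/-! ### Stochastic integrals and the Itô isometry. -/

section StochInt

variable {Ω : Type*} [MeasurableSpace Ω] {P : Measure Ω}
  {F : Measure ℝ} {Z : Set ℝ → Ω → ℂ}

theorem measure_preimage_ne_top {s : SimpleFunc ℝ ℂ} (hs : MemLp s 2 F) {c : ℂ} (hc : c ≠ 0) :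
    F (s ⁻¹' {c}) ≠ ∞ :=
  (SimpleFunc.measure_preimage_lt_top_of_memLp (by norm_num) (by norm_num) s hs c hc).ne

theorem memLp_mul_randomMeasure (hZ : IsSymmGaussianRandomMeasure P F Z) {s : SimpleFunc ℝ ℂ}
    (hs : MemLp s 2 F) (c : ℂ) : MemLp (fun ω => c * Z (s ⁻¹' {c}) ω) 2 P := by
  -- The level set of the value `0` may have infinite measure, where nothing is known about `Z`; its
  -- coefficient removes it.
  by_cases hc : c = 0
  · simp [hc]
  · exact (memLp_randomMeasure hZ (s.measurableSet_fiber c) (measure_preimage_ne_top hs hc)).const_mul c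

theorem memLp_simpleStochInt (hZ : IsSymmGaussianRandomMeasure P F Z) {s : SimpleFunc ℝ ℂ}
    (hs : MemLp s 2 F) : MemLp (simpleStochInt Z s) 2 P :=
  memLp_finsetSum _ fun c _ => memLp_mul_randomMeasure hZ hs c

theorem simpleFunc_eq_sum_indicator (s : SimpleFunc ℝ ℂ) (v : ℝ) :
    s v = ∑ c ∈ s.range, c * (s ⁻¹' {c}).indicator 1 v := by
  rw [Finset.sum_eq_single (s v)]
  · simp
  · intro c _ hc
    rw [Set.indicator_of_notMem (by simpa using hc.symm), mul_zero]
  · intro h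
    exact absurd (SimpleFunc.mem_range_self s v) h

/-- Both sides expand over pairs of level sets. Orthogonality of `Z` gives the measure of each
intersection, which is also the integral of the product of the indicators. -/
theorem integral_simpleStochInt_mul_conj (hZ : IsSymmGaussianRandomMeasure P F Z)
    {s r : SimpleFunc ℝ ℂ} (hs : MemLp s 2 F) (hr : MemLp r 2 F) :
    ∫ ω, simpleStochInt Z s ω * conj (simpleStochInt Z r ω) ∂P = ∫ v, s v * conj (r v) ∂F := by
  have hi : ∀ c d, Integrable (fun ω => c * Z (s ⁻¹' {c}) ω * conj (d * Z (r ⁻¹' {d}) ω)) P :=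
    fun c d => (memLp_mul_randomMeasure hZ hs c).integrable_mul
      (memLp_mul_randomMeasure hZ hr d).star
  have e1 : ∀ ω, simpleStochInt Z s ω * conj (simpleStochInt Z r ω) =
      ∑ c ∈ s.range, ∑ d ∈ r.range, c * Z (s ⁻¹' {c}) ω * conj (d * Z (r ⁻¹' {d}) ω) := by
    intro ω
    rw [simpleStochInt, simpleStochInt, map_sum, Finset.sum_mul_sum]
  have e2 : ∀ v, s v * conj (r v) = ∑ c ∈ s.range, ∑ d ∈ r.range,
      c * conj d * (s ⁻¹' {c} ∩ r ⁻¹' {d}).indicator 1 v := by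
    intro v
    rw [simpleFunc_eq_sum_indicator s v, simpleFunc_eq_sum_indicator r v, map_sum,
      Finset.sum_mul_sum]
    refine Finset.sum_congr rfl fun c _ => Finset.sum_congr rfl fun d _ => ?_
    rw [Set.inter_indicator_one, Pi.mul_apply, map_mul]
    have : conj ((r ⁻¹' {d}).indicator (1 : ℝ → ℂ) v) = (r ⁻¹' {d}).indicator (1 : ℝ → ℂ) v := by
      by_cases h : v ∈ r ⁻¹' {d} <;> simp [h]
    rw [this]
    ring
  have hi2 : ∀ c d, Integrable (fun v => c * conj d *
      (s ⁻¹' {c} ∩ r ⁻¹' {d}).indicator (1 : ℝ → ℂ) v) F := by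
    intro c d
    by_cases hc : c = 0
    · simp [hc]
    · refine Integrable.const_mul ?_ _
      refine (integrable_indicator_iff ((s.measurableSet_fiber c).inter
        (r.measurableSet_fiber d))).2 (integrableOn_const ?_)
      exact measure_ne_top_of_subset Set.inter_subset_left (measure_preimage_ne_top hs hc)
  simp only [e1, e2]
  rw [integral_finsetSum _ fun c _ => integrable_finsetSum _ fun d _ => hi c d,
    integral_finsetSum _ fun c _ => integrable_finsetSum _ fun d _ => hi2 c d]
  refine Finset.sum_congr rfl fun c _ => ?_
  rw [integral_finsetSum _ fun d _ => hi c d, integral_finsetSum _ fun d _ => hi2 c d]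
  refine Finset.sum_congr rfl fun d _ => ?_
  by_cases hc : c = 0
  · simp [hc]
  by_cases hd : d = 0
  · simp [hd]
  have e3 : ∫ v, (s ⁻¹' {c} ∩ r ⁻¹' {d}).indicator (1 : ℝ → ℂ) v ∂F =
      ((F (s ⁻¹' {c} ∩ r ⁻¹' {d})).toReal : ℂ) := by
    have := integral_indicator_const (μ := F) (1 : ℂ) ((s.measurableSet_fiber c).inter
        (r.measurableSet_fiber d))
    rw [Complex.real_smul, mul_one] at this
    exact this
  have := hZ.orthogonal _ _ (s.measurableSet_fiber c) (measure_preimage_ne_top hs hc)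
    (r.measurableSet_fiber d) (measure_preimage_ne_top hr hd)
  rw [integral_const_mul, e3, ← this, ← integral_const_mul]
  refine integral_congr_ae (ae_of_all _ fun ω => ?_)
  simp only [map_mul]
  ring

theorem inner_toLp_complex {α : Type*} [MeasurableSpace α] {ν : Measure α} {f g : α → ℂ}
    (hf : MemLp f 2 ν) (hg : MemLp g 2 ν) :
    inner ℂ (hg.toLp g) (hf.toLp f) = ∫ a, f a * conj (g a) ∂ν := by
  rw [L2.inner_def]
  refine integral_congr_ae ?_
  filter_upwards [hf.coeFn_toLp, hg.coeFn_toLp] with a h1 h2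
  rw [h1, h2, RCLike.inner_apply]

/-- Expanding the squared norm into four inner products avoids identifying the difference of two
simple integrals with the integral of the difference. -/
theorem norm_toLp_simpleStochInt_sub (hZ : IsSymmGaussianRandomMeasure P F Z)
    {s r : SimpleFunc ℝ ℂ} (hs : MemLp s 2 F) (hr : MemLp r 2 F) :
    ‖(memLp_simpleStochInt hZ hs).toLp _ - (memLp_simpleStochInt hZ hr).toLp _‖ =
      ‖hs.toLp s - hr.toLp r‖ := by
  have h : ∀ {s r : SimpleFunc ℝ ℂ} (hs : MemLp s 2 F) (hr : MemLp r 2 F),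
      inner ℂ ((memLp_simpleStochInt hZ hr).toLp _) ((memLp_simpleStochInt hZ hs).toLp _) =
        inner ℂ (hr.toLp r) (hs.toLp s) := by
    intro s r hs hr
    rw [inner_toLp_complex, inner_toLp_complex, integral_simpleStochInt_mul_conj hZ hs hr]
  rw [← sq_eq_sq₀ (norm_nonneg _) (norm_nonneg _), ← Complex.ofReal_inj]
  push_cast
  have key := fun x : Lp ℂ 2 P => (inner_self_eq_norm_sq_to_K (𝕜 := ℂ) x).symm
  have key' := fun x : Lp ℂ 2 F => (inner_self_eq_norm_sq_to_K (𝕜 := ℂ) x).symm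
  simp only [Complex.coe_algebraMap] at key key'
  rw [key, key']
  simp only [inner_sub_left, inner_sub_right, h hs hr, h hr hs, h hs hs, h hr hr]

theorem tendsto_toLp_of_tendsto_eLpNorm {α : Type*} [MeasurableSpace α] {ν : Measure α}
    {f : ℕ → α → ℂ} {g : α → ℂ} (hf : ∀ n, MemLp (f n) 2 ν) (hg : MemLp g 2 ν)
    (h : Tendsto (fun n => eLpNorm (fun a => g a - f n a) 2 ν) atTop (𝓝 0)) :
    Tendsto (fun n => (hf n).toLp (f n)) atTop (𝓝 (hg.toLp g)) := by
  rw [Lp.tendsto_Lp_iff_tendsto_eLpNorm'']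
  simp only [eLpNorm_sub_comm _ g]
  exact h

/-- The isometry turns an approximating sequence in `L²(F)` into a Cauchy sequence in `L²(P)`, and
completeness gives the limit. -/
theorem exists_isStochInt (hZ : IsSymmGaussianRandomMeasure P F Z) {φ : ℝ → ℂ}
    (hφ : MemLp φ 2 F) : ∃ X, IsStochInt P F Z φ X := by
  have hε : ∀ n : ℕ, ((n : ℝ≥0∞) + 1)⁻¹ ≠ 0 := fun n => by simp
  choose s hs hs2 using fun n : ℕ =>
    hφ.exists_simpleFunc_eLpNorm_sub_lt (by norm_num) (hε n)
  have hlim : Tendsto (fun n => eLpNorm (φ - ⇑(s n)) 2 F) atTop (𝓝 0) := by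
    refine tendsto_of_tendsto_of_tendsto_of_le_of_le tendsto_const_nhds ?_
      (fun _ => zero_le) (fun n => (hs n).le)
    have := (tendsto_add_atTop_iff_nat 1).2 ENNReal.tendsto_inv_nat_nhds_zero
    simpa using this
  have hL : Tendsto (fun n => (hs2 n).toLp (s n)) atTop (𝓝 (hφ.toLp φ)) :=
    tendsto_toLp_of_tendsto_eLpNorm hs2 hφ hlim
  have hC : CauchySeq (fun n => (memLp_simpleStochInt hZ (hs2 n)).toLp _) := by
    have h1 := hL.cauchySeq
    rw [Metric.cauchySeq_iff] at h1 ⊢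
    intro ε hε
    obtain ⟨N, hN⟩ := h1 ε hε
    refine ⟨N, fun m hm n hn => ?_⟩
    rw [dist_eq_norm, norm_toLp_simpleStochInt_sub hZ (hs2 m) (hs2 n), ← dist_eq_norm]
    exact hN m hm n hn
  obtain ⟨X, hX⟩ := cauchySeq_tendsto_of_complete hC
  refine ⟨X, Lp.memLp X, s, hs2, hlim, ?_⟩
  rw [← Lp.toLp_coeFn X (Lp.memLp X), Lp.tendsto_Lp_iff_tendsto_eLpNorm''] at hX
  change Tendsto (fun i => eLpNorm (⇑X - simpleStochInt Z (s i)) 2 P) atTop (𝓝 0)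
  simpa only [eLpNorm_sub_comm] using hX

theorem isStochInt_stochInt (hZ : IsSymmGaussianRandomMeasure P F Z) {φ : ℝ → ℂ}
    (hφ : MemLp φ 2 F) : IsStochInt P F Z φ (stochInt P F Z φ) := by
  rw [stochInt, dif_pos (exists_isStochInt hZ hφ)]
  exact (exists_isStochInt hZ hφ).choose_spec

/-- The Itô isometry. -/
theorem IsStochInt.integral_mul_conj (hZ : IsSymmGaussianRandomMeasure P F Z) {φ ψ : ℝ → ℂ}
    (hφ : MemLp φ 2 F) (hψ : MemLp ψ 2 F) {X Y : Ω → ℂ} (hX : IsStochInt P F Z φ X)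
    (hY : IsStochInt P F Z ψ Y) :
    ∫ ω, X ω * conj (Y ω) ∂P = ∫ v, φ v * conj (ψ v) ∂F := by
  obtain ⟨hX, s, hs, hsφ, hsX⟩ := hX
  obtain ⟨hY, r, hr, hrψ, hrY⟩ := hY
  have h1 : Tendsto (fun n => (hs n).toLp (s n)) atTop (𝓝 (hφ.toLp φ)) :=
    tendsto_toLp_of_tendsto_eLpNorm (hs) hφ hsφ
  have h2 : Tendsto (fun n => (hr n).toLp (r n)) atTop (𝓝 (hψ.toLp ψ)) :=
    tendsto_toLp_of_tendsto_eLpNorm (hr) hψ hrψ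
  have h3 : Tendsto (fun n => (memLp_simpleStochInt hZ (hs n)).toLp _) atTop
      (𝓝 (hX.toLp X)) :=
    tendsto_toLp_of_tendsto_eLpNorm (fun n => memLp_simpleStochInt hZ (hs n)) hX hsX
  have h4 : Tendsto (fun n => (memLp_simpleStochInt hZ (hr n)).toLp _) atTop
      (𝓝 (hY.toLp Y)) :=
    tendsto_toLp_of_tendsto_eLpNorm (fun n => memLp_simpleStochInt hZ (hr n)) hY hrY
  have h5 := h2.inner (𝕜 := ℂ) h1
  have h6 := h4.inner (𝕜 := ℂ) h3
  simp only [inner_toLp_complex] at h5 h6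
  simp only [integral_simpleStochInt_mul_conj hZ (hs _) (hr _)] at h6
  exact tendsto_nhds_unique h6 h5

theorem memGaussianSpace_re_simpleStochInt (hZ : IsSymmGaussianRandomMeasure P F Z)
    {s : SimpleFunc ℝ ℂ} (hs : MemLp s 2 F) :
    MemGaussianSpace P F Z (fun ω => (simpleStochInt Z s ω).re) := by
  have e : ∀ ω, (simpleStochInt Z s ω).re = ∑ c ∈ s.range, (c * Z (s ⁻¹' {c}) ω).re := by
    intro ω
    rw [simpleStochInt, Complex.re_sum]
  simp only [e]
  refine MemGaussianSpace.sum _ fun c _ => ?_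
  by_cases hc : c = 0
  · simpa [hc] using MemGaussianSpace.zero
  have hA := s.measurableSet_fiber c
  have hFA := measure_preimage_ne_top hs hc
  have hm := memLp_randomMeasure hZ hA hFA
  have hre : MemGaussianSpace P F Z (fun ω => (Z (s ⁻¹' {c}) ω).re) :=
    ⟨hm.re, Submodule.le_topologicalClosure _ (Submodule.subset_span
      ⟨_, hA, hFA, Or.inl hm.re.coeFn_toLp⟩)⟩
  have him : MemGaussianSpace P F Z (fun ω => (Z (s ⁻¹' {c}) ω).im) :=
    ⟨hm.im, Submodule.le_topologicalClosure _ (Submodule.subset_span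
      ⟨_, hA, hFA, Or.inr hm.im.coeFn_toLp⟩)⟩
  -- The real part of a complex multiple mixes both coordinates of `Z`, which is why the span
  -- contains both.
  have := (hre.const_mul c.re).add (him.const_mul (-c.im))
  refine this.congr (ae_of_all _ fun ω => ?_)
  simp only [Complex.mul_re]
  ring

theorem IsStochInt.memGaussianSpace_re (hZ : IsSymmGaussianRandomMeasure P F Z) {φ : ℝ → ℂ}
    {X : Ω → ℂ} (hX : IsStochInt P F Z φ X) : MemGaussianSpace P F Z (fun ω => (X ω).re) := by
  obtain ⟨hX, s, hs, -, hsX⟩ := hX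
  refine ⟨hX.re, ?_⟩
  have hr := fun n => memGaussianSpace_re_simpleStochInt hZ (hs n)
  refine (Submodule.isClosed_topologicalClosure _).mem_of_tendsto
    (f := fun n => (hr n).1.toLp _) (b := atTop) ?_ (Eventually.of_forall fun n => (hr n).2)
  rw [Lp.tendsto_Lp_iff_tendsto_eLpNorm'']
  refine tendsto_of_tendsto_of_tendsto_of_le_of_le tendsto_const_nhds hsX
    (fun _ => zero_le) (fun n => ?_)
  refine eLpNorm_mono fun ω => ?_
  simp only [Pi.sub_apply]
  rw [norm_sub_rev (X ω), Real.norm_eq_abs]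
  exact Complex.abs_re_le_norm (simpleStochInt Z (s n) ω - X ω)

/-- A real random variable which is a real multiple of a stochastic integral lies in the
Gaussian space. -/
theorem memGaussianSpace_of_ae_eq (hZ : IsSymmGaussianRandomMeasure P F Z) {φ : ℝ → ℂ}
    (hφ : MemLp φ 2 F) {c : ℝ} {X : Ω → ℝ}
    (hX : (fun ω => (X ω : ℂ)) =ᵐ[P] fun ω => (c : ℂ) * stochInt P F Z φ ω) :
    MemGaussianSpace P F Z X := by
  refine (((isStochInt_stochInt hZ hφ).memGaussianSpace_re hZ).const_mul c).congr ?_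
  filter_upwards [hX] with ω hω
  rw [← Complex.re_ofReal_mul, ← hω, Complex.ofReal_re]

theorem integral_mul_of_ae_eq (hZ : IsSymmGaussianRandomMeasure P F Z) {φ ψ : ℝ → ℂ}
    (hφ : MemLp φ 2 F) (hψ : MemLp ψ 2 F) {c d : ℝ} {X Y : Ω → ℝ}
    (hX : (fun ω => (X ω : ℂ)) =ᵐ[P] fun ω => (c : ℂ) * stochInt P F Z φ ω)
    (hY : (fun ω => (Y ω : ℂ)) =ᵐ[P] fun ω => (d : ℂ) * stochInt P F Z ψ ω) :
    ((∫ ω, X ω * Y ω ∂P : ℝ) : ℂ) = c * d * ∫ v, φ v * conj (ψ v) ∂F := by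
  rw [← (isStochInt_stochInt hZ hφ).integral_mul_conj hZ hφ hψ (isStochInt_stochInt hZ hψ),
    ← integral_const_mul, ← integral_complex_ofReal]
  refine integral_congr_ae ?_
  filter_upwards [hX, hY] with ω h1 h2
  -- A real variable equals its conjugate, which supplies the conjugation in the isometry.
  have h3 : (Y ω : ℂ) = d * conj (stochInt P F Z ψ ω) := by
    rw [← Complex.conj_ofReal (Y ω), h2, map_mul, Complex.conj_ofReal]
  push_cast
  rw [h3, h1]
  ring

end StochInt

/-! ### Spatial averages of square integrable random fields. -/

/-- Cauchy–Schwarz against the constant `1`, read off from the nonnegative integral of `(f - c)²`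
with `c` the mean of `f`. -/
theorem sq_integral_le {α : Type*} [MeasurableSpace α] {ν : Measure α} [IsFiniteMeasure ν]
    {f : α → ℝ} (hf : MemLp f 2 ν) :
    (∫ a, f a ∂ν) ^ 2 ≤ ν.real Set.univ * ∫ a, f a ^ 2 ∂ν := by
  rcases eq_or_ne ν 0 with rfl | h0
  · simp
  have hm : 0 < ν.real Set.univ := by
    rw [measureReal_def]
    exact ENNReal.toReal_pos (by simpa using h0) (measure_ne_top _ _)
  have h1 : Integrable f ν := hf.integrable (by norm_num)
  have h2 : Integrable (fun a => f a ^ 2) ν := hf.integrable_sq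
  set c := (∫ a, f a ∂ν) / ν.real Set.univ with hc
  have h3 : 0 ≤ ∫ a, (f a - c) ^ 2 ∂ν := integral_nonneg fun a => sq_nonneg _
  have e : ∀ a, (f a - c) ^ 2 = f a ^ 2 - 2 * c * f a + c ^ 2 := fun a => by ring
  simp only [e] at h3
  rw [integral_add (f := fun a => f a ^ 2 - 2 * c * f a) (h2.sub (h1.const_mul _))
    (integrable_const _), integral_sub h2 (h1.const_mul _),
    integral_const_mul, integral_const, smul_eq_mul] at h3
  have h4 : ∫ a, f a ∂ν = c * ν.real Set.univ := by rw [hc]; field_simp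
  rw [h4] at h3 ⊢
  nlinarith

section Smoothing

variable {Ω : Type*} [MeasurableSpace Ω] {P : Measure Ω} [IsProbabilityMeasure P]
  {F : Measure ℝ} {Z : Set ℝ → Ω → ℂ} {ν : Measure ℝ} [IsFiniteMeasure ν]
  {ξ : ℝ → Ω → ℝ}

/-- By `|ab| ≤ (a² + b²) / 2` and the uniform second moment bound, the inner integrals are bounded
by a constant, which is integrable for the finite measure `ν`. This justifies Fubini below. -/
theorem integrable_prod_mul (hm : AEStronglyMeasurable (fun p : ℝ × Ω => ξ p.1 p.2) (ν.prod P))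
    (hξ : ∀ x, MemLp (ξ x) 2 P) {B : ℝ} (hB : ∀ x, ∫ ω, ξ x ω ^ 2 ∂P ≤ B) {X : Ω → ℝ}
    (hX : MemLp X 2 P) : Integrable (fun p : ℝ × Ω => ξ p.1 p.2 * X p.2) (ν.prod P) := by
  have hm2 : AEStronglyMeasurable (fun p : ℝ × Ω => ξ p.1 p.2 * X p.2) (ν.prod P) :=
    hm.mul hX.1.comp_snd
  rw [integrable_prod_iff hm2]
  refine ⟨ae_of_all _ fun x => (hξ x).integrable_mul hX, ?_⟩
  refine Integrable.of_bound (C := (B + ∫ ω, X ω ^ 2 ∂P) / 2) hm2.norm.integral_prod_right'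
    (ae_of_all _ fun x => ?_)
  rw [Real.norm_of_nonneg (integral_nonneg fun _ => norm_nonneg _)]
  have h1 : ∫ ω, ‖ξ x ω * X ω‖ ∂P ≤ ∫ ω, (ξ x ω ^ 2 + X ω ^ 2) / 2 ∂P := by
    refine integral_mono ((hξ x).integrable_mul hX).norm
      (((hξ x).integrable_sq.add hX.integrable_sq).div_const 2) fun ω => ?_
    simp only [norm_mul, Real.norm_eq_abs]
    nlinarith [sq_nonneg (|ξ x ω| - |X ω|), sq_abs (ξ x ω), sq_abs (X ω)]
  rw [integral_div, integral_add (hξ x).integrable_sq hX.integrable_sq] at h1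
  linarith [hB x]

theorem integrable_prod_sq (hm : AEStronglyMeasurable (fun p : ℝ × Ω => ξ p.1 p.2) (ν.prod P))
    (hξ : ∀ x, MemLp (ξ x) 2 P) {B : ℝ} (hB : ∀ x, ∫ ω, ξ x ω ^ 2 ∂P ≤ B) :
    Integrable (fun p : ℝ × Ω => ξ p.1 p.2 ^ 2) (ν.prod P) := by
  have hm2 : AEStronglyMeasurable (fun p : ℝ × Ω => ξ p.1 p.2 ^ 2) (ν.prod P) := hm.pow 2
  rw [integrable_prod_iff hm2]
  refine ⟨ae_of_all _ fun x => (hξ x).integrable_sq, ?_⟩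
  refine Integrable.of_bound (C := B) hm2.norm.integral_prod_right' (ae_of_all _ fun x => ?_)
  rw [Real.norm_of_nonneg (integral_nonneg fun _ => norm_nonneg _)]
  simpa using hB x

theorem ae_memLp_two_section
    (hm : AEStronglyMeasurable (fun p : ℝ × Ω => ξ p.1 p.2) (ν.prod P))
    (hξ : ∀ x, MemLp (ξ x) 2 P) {B : ℝ} (hB : ∀ x, ∫ ω, ξ x ω ^ 2 ∂P ≤ B) :
    ∀ᵐ ω ∂P, MemLp (fun x => ξ x ω) 2 ν := by
  have h1 : ∀ᵐ ω ∂P, AEStronglyMeasurable (fun x => ξ x ω) ν :=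
    hm.prod_swap.prodMk_left
  filter_upwards [(integrable_prod_sq hm hξ hB).prod_left_ae, h1] with ω h2 h1
  exact (memLp_two_iff_integrable_sq h1).2 h2

theorem memLp_integral_field
    (hm : AEStronglyMeasurable (fun p : ℝ × Ω => ξ p.1 p.2) (ν.prod P))
    (hξ : ∀ x, MemLp (ξ x) 2 P) {B : ℝ} (hB : ∀ x, ∫ ω, ξ x ω ^ 2 ∂P ≤ B) :
    MemLp (fun ω => ∫ x, ξ x ω ∂ν) 2 P := by
  have hYm : AEStronglyMeasurable (fun ω => ∫ x, ξ x ω ∂ν) P :=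
    hm.prod_swap.integral_prod_right'
  rw [memLp_two_iff_integrable_sq hYm]
  refine ((integrable_prod_sq hm hξ hB).integral_prod_right.const_mul (ν.real Set.univ)).mono'
    (hYm.pow 2) ?_
  filter_upwards [ae_memLp_two_section hm hξ hB] with ω hω
  rw [Real.norm_of_nonneg (sq_nonneg _)]
  exact sq_integral_le hω

/-- Expectations may be taken under the spatial integral. -/
theorem integral_integral_field_mul
    (hm : AEStronglyMeasurable (fun p : ℝ × Ω => ξ p.1 p.2) (ν.prod P))
    (hξ : ∀ x, MemLp (ξ x) 2 P) {B : ℝ} (hB : ∀ x, ∫ ω, ξ x ω ^ 2 ∂P ≤ B) {X : Ω → ℝ}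
    (hX : MemLp X 2 P) :
    ∫ ω, (∫ x, ξ x ω ∂ν) * X ω ∂P = ∫ x, ∫ ω, ξ x ω * X ω ∂P ∂ν := by
  rw [integral_integral_swap (integrable_prod_mul hm hξ hB hX)]
  simp only [integral_mul_const]

/-- The Gaussian space is closed under integration of fields. -/
theorem memGaussianSpace_integral
    (hm : AEStronglyMeasurable (fun p : ℝ × Ω => ξ p.1 p.2) (ν.prod P))
    (hξ : ∀ x, MemGaussianSpace P F Z (ξ x)) {B : ℝ} (hB : ∀ x, ∫ ω, ξ x ω ^ 2 ∂P ≤ B) :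
    MemGaussianSpace P F Z (fun ω => ∫ x, ξ x ω ∂ν) := by
  have hY := memLp_integral_field hm (fun x => (hξ x).1) hB
  refine ⟨hY, ?_⟩
  -- The closure is the double orthogonal complement. It suffices to test against variables
  -- orthogonal to the span, and Fubini moves such a test inside the spatial integral, where it
  -- vanishes pointwise.
  rw [← Submodule.orthogonal_orthogonal_eq_closure, Submodule.mem_orthogonal']
  intro X hX
  have e : inner ℝ (hY.toLp _) X = ∫ ω, (∫ x, ξ x ω ∂ν) * X ω ∂P := by
    rw [L2.inner_def]
    refine integral_congr_ae ?_
    filter_upwards [hY.coeFn_toLp] with ω hω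
    rw [hω]
    simp [mul_comm]
  rw [e, integral_integral_field_mul hm (fun x => (hξ x).1) hB (Lp.memLp X)]
  have h0 : ∀ x, ∫ ω, ξ x ω * X ω ∂P = 0 := by
    intro x
    have h1 : inner ℝ ((hξ x).1.toLp _) X = 0 := by
      rw [Submodule.mem_orthogonal] at hX
      have h2 : X ∈ (gaussianSpan P F Z).topologicalClosureᗮ := by
        rwa [Submodule.orthogonal_closure]
      exact (Submodule.mem_orthogonal _ _).1 h2 _ (hξ x).2
    rw [← h1, L2.inner_def]
    refine integral_congr_ae ?_
    filter_upwards [(hξ x).1.coeFn_toLp] with ω hω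
    rw [hω]
    simp [mul_comm]
  simp [h0]

end Smoothing

/-! ### Gaussian smoothing of cosines. -/

section GaussKernel

theorem integrable_gaussKernel (x : ℝ) : Integrable (fun y => gaussKernel y x) := by
  have h := (integrable_exp_neg_mul_sq (b := 1) one_pos).comp_sub_right x
  simpa [gaussKernel] using h

/-- The finite measure with density `gaussKernel · x`. -/
noncomputable def gaussMeasure (x : ℝ) : Measure ℝ :=
  volume.withDensity fun y => ENNReal.ofReal (gaussKernel y x)

instance (x : ℝ) : IsFiniteMeasure (gaussMeasure x) :=
  isFiniteMeasure_withDensity_ofReal (integrable_gaussKernel x).2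

theorem measurable_gaussKernel (x : ℝ) : Measurable (fun y => gaussKernel y x) := by
  unfold gaussKernel
  fun_prop

theorem gaussKernel_pos (y x : ℝ) : 0 < gaussKernel y x := Real.exp_pos _

theorem integral_gaussMeasure {E : Type*} [NormedAddCommGroup E] [NormedSpace ℝ E] (x : ℝ)
    (f : ℝ → E) : ∫ y, f y ∂gaussMeasure x = ∫ y, gaussKernel y x • f y := by
  rw [gaussMeasure, integral_withDensity_eq_integral_toReal_smul
    (measurable_gaussKernel x).ennreal_ofReal (ae_of_all _ fun _ => ENNReal.ofReal_lt_top)]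
  simp [(gaussKernel_pos _ x).le]

theorem integral_exp_neg_sq_mul_cexp (a : ℝ) :
    ∫ y : ℝ, Complex.exp (-(y : ℂ) ^ 2) * Complex.exp (Complex.I * (a * y : ℝ)) =
      (√Real.pi * Real.exp (-a ^ 2 / 4) : ℝ) := by
  have h := integral_cexp_quadratic (b := -1) (by simp) (Complex.I * a) 0
  have e : ∀ y : ℝ, Complex.exp (-(y : ℂ) ^ 2) * Complex.exp (Complex.I * (a * y : ℝ)) =
      Complex.exp (-1 * (y : ℂ) ^ 2 + Complex.I * a * y + 0) := by
    intro y
    rw [← Complex.exp_add]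
    push_cast
    ring_nf
  simp only [e]
  rw [h]
  have h2 : ((Real.pi : ℂ) / -(-1)) ^ (1 / 2 : ℂ) = (√Real.pi : ℝ) := by
    rw [Real.sqrt_eq_rpow, Complex.ofReal_cpow Real.pi_pos.le]
    push_cast
    norm_num
  rw [h2]
  push_cast
  congr 2
  rw [mul_pow, Complex.I_sq]
  ring

/-- Once the kernel is centred, this is the real part of a Gaussian Fourier integral times a
constant phase factor. -/
theorem integral_gaussKernel_mul_cos (x a b : ℝ) :
    ∫ y, gaussKernel y x * Real.cos (a * y + b) =
      √Real.pi * Real.exp (-a ^ 2 / 4) * Real.cos (a * x + b) := by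
  rw [← integral_add_right_eq_self _ x]
  have e : ∀ y : ℝ, gaussKernel (y + x) x * Real.cos (a * (y + x) + b) =
      (Complex.exp (-(y : ℂ) ^ 2) * Complex.exp (Complex.I * (a * y : ℝ)) *
        Complex.exp (Complex.I * (a * x + b : ℝ))).re := by
    intro y
    rw [mul_assoc, ← Complex.exp_add, show (-(y : ℂ) ^ 2) = ((-y ^ 2 : ℝ) : ℂ) by push_cast; ring,
      ← Complex.ofReal_exp, Complex.re_ofReal_mul,
      show Complex.I * ((a * y : ℝ) : ℂ) + Complex.I * ((a * x + b : ℝ) : ℂ) =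
        ((a * (y + x) + b : ℝ) : ℂ) * Complex.I by push_cast; ring, Complex.exp_ofReal_mul_I_re]
    simp [gaussKernel]
  simp only [e]
  have hi : Integrable (fun y : ℝ => Complex.exp (-(y : ℂ) ^ 2) *
      Complex.exp (Complex.I * (a * y : ℝ)) * Complex.exp (Complex.I * (a * x + b : ℝ))) := by
    refine Integrable.mul_const ?_ _
    refine (integrable_exp_neg_mul_sq (b := 1) one_pos).mono'
      (by fun_prop : Continuous fun y : ℝ => Complex.exp (-(y : ℂ) ^ 2) *
      Complex.exp (Complex.I * (a * y : ℝ))).aestronglyMeasurable (ae_of_all _ fun y => ?_)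
    rw [norm_mul, mul_comm Complex.I, Complex.norm_exp_ofReal_mul_I, Complex.norm_exp]
    simp [← Complex.ofReal_pow]
  have := integral_re hi
  simp only [RCLike.re_eq_complex_re] at this
  rw [this, integral_mul_const, integral_exp_neg_sq_mul_cexp, Complex.re_ofReal_mul,
    mul_comm Complex.I, Complex.exp_ofReal_mul_I_re]

/-- Gaussian smoothing of a superposition of cosines. -/
theorem integral_gaussMeasure_integral_cos {F : Measure ℝ} [IsFiniteMeasure F] {k a b : ℝ → ℝ}
    (hk : Measurable k) {C : ℝ} (hkC : ∀ v, |k v| ≤ C) (ha : Measurable a) (hb : Measurable b)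
    (x : ℝ) :
    ∫ y, ∫ v, k v * Real.cos (a v * y + b v) ∂F ∂gaussMeasure x =
      ∫ v, √Real.pi * Real.exp (-a v ^ 2 / 4) * k v * Real.cos (a v * x + b v) ∂F := by
  rw [integral_integral_swap]
  · refine integral_congr_ae (ae_of_all _ fun v => ?_)
    simp only
    rw [integral_const_mul, integral_gaussMeasure]
    simp only [smul_eq_mul]
    rw [integral_gaussKernel_mul_cos]
    ring
  · refine Integrable.of_bound (C := C) ?_ (ae_of_all _ fun p => ?_)
    · refine Measurable.aestronglyMeasurable ?_
      simp only [Function.uncurry_def]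
      fun_prop
    · simp only [Function.uncurry_def, norm_mul, Real.norm_eq_abs]
      exact (mul_le_of_le_one_right (abs_nonneg _) (Real.abs_cos_le_one _)).trans (hkC _)

end GaussKernel

/-! ### The spectral density of `(1 + x²)^(-κ/2)`. -/

section MaternDensity

/-- The Gaussian density of variance `2 s`, weighted by the Gamma density. -/
noncomputable def gammaMixture (κ s v : ℝ) : ℝ :=
  s ^ (κ / 2 - 1) * Real.exp (-s) * ((√(4 * Real.pi * s))⁻¹ * Real.exp (-(4 * s)⁻¹ * v ^ 2))

/-- The spectral density of the covariance function `(1 + x²) ^ (-κ/2)`. -/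
noncomputable def maternDensity (κ v : ℝ) : ℝ :=
  (Real.Gamma (κ / 2))⁻¹ * ∫ s in Set.Ioi 0, gammaMixture κ s v

theorem sqrt_four_pi_mul (s : ℝ) :
    √(4 * Real.pi * s) = 2 * √Real.pi * s ^ (1 / 2 : ℝ) := by
  rw [Real.sqrt_mul (by have := Real.pi_pos; positivity), Real.sqrt_mul (by norm_num),
    ← Real.sqrt_eq_rpow]
  congr 2
  rw [show (4 : ℝ) = 2 ^ 2 by norm_num, Real.sqrt_sq (by norm_num)]

theorem gammaMixture_nonneg {κ s : ℝ} (hs : 0 < s) (v : ℝ) : 0 ≤ gammaMixture κ s v := by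
  unfold gammaMixture
  positivity

theorem measurable_gammaMixture (κ : ℝ) :
    Measurable (fun p : ℝ × ℝ => gammaMixture κ p.1 p.2) := by
  unfold gammaMixture
  fun_prop

theorem integral_gammaMixture {κ s : ℝ} (hs : 0 < s) :
    ∫ v, gammaMixture κ s v = s ^ (κ / 2 - 1) * Real.exp (-s) := by
  unfold gammaMixture
  rw [integral_const_mul, integral_const_mul, integral_gaussian,
    show Real.pi / (4 * s)⁻¹ = 4 * Real.pi * s by rw [div_inv_eq_mul]; ring, inv_mul_cancel₀, mul_one]
  have := Real.pi_pos
  positivity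

theorem integrable_gammaMixture_right {κ s : ℝ} (hs : 0 < s) :
    Integrable (fun v => gammaMixture κ s v) :=
  ((integrable_exp_neg_mul_sq (by positivity)).const_mul _).const_mul _

theorem integrable_gammaMixture_prod {κ : ℝ} (hκ : 0 < κ) :
    Integrable (fun p : ℝ × ℝ => gammaMixture κ p.1 p.2)
      ((volume.restrict (Set.Ioi 0)).prod volume) := by
  rw [integrable_prod_iff (measurable_gammaMixture κ).aestronglyMeasurable]
  constructor
  · filter_upwards [ae_restrict_mem measurableSet_Ioi] with s hs
    exact integrable_gammaMixture_right hs
  · refine (Real.GammaIntegral_convergent (s := κ / 2) (by positivity)).congr ?_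
    filter_upwards [ae_restrict_mem measurableSet_Ioi] with s hs
    rw [mul_comm, ← integral_gammaMixture hs]
    refine integral_congr_ae (ae_of_all _ fun v => ?_)
    simp only
    rw [Real.norm_of_nonneg (gammaMixture_nonneg hs v)]

theorem integrable_maternDensity {κ : ℝ} (hκ : 0 < κ) : Integrable (maternDensity κ) :=
  (integrable_gammaMixture_prod hκ).integral_prod_right.const_mul _

/-- The Gaussian of variance `2s` has characteristic function `exp(-s x²)`, which merges with the
factor `exp(-s)` of the Gamma weight. -/
theorem integral_cexp_mul_gammaMixture {κ s : ℝ} (hs : 0 < s) (x : ℝ) :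
    ∫ v : ℝ, Complex.exp (Complex.I * (x * v : ℝ)) * (gammaMixture κ s v : ℝ) =
      ((s ^ (κ / 2 - 1) * Real.exp (-((1 + x ^ 2) * s)) : ℝ) : ℂ) := by
  have h := fourierIntegral_gaussian (b := (((4 * s)⁻¹ : ℝ) : ℂ))
    (by rw [Complex.ofReal_re]; positivity) (x : ℂ)
  have e : ∀ v : ℝ, Complex.exp (Complex.I * (x * v : ℝ)) * (gammaMixture κ s v : ℝ) =
      ((s ^ (κ / 2 - 1) * Real.exp (-s) * (√(4 * Real.pi * s))⁻¹ : ℝ) : ℂ) *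
        (Complex.exp (Complex.I * x * v) *
          Complex.exp (-(((4 * s)⁻¹ : ℝ) : ℂ) * (v : ℂ) ^ 2)) := by
    intro v
    unfold gammaMixture
    push_cast
    ring_nf
  simp only [e]
  rw [integral_const_mul, h]
  have h2 : ((Real.pi : ℂ) / (((4 * s)⁻¹ : ℝ) : ℂ)) ^ (1 / 2 : ℂ) = (√(4 * Real.pi * s) : ℝ) := by
    rw [Real.sqrt_eq_rpow, Complex.ofReal_cpow (by have := Real.pi_pos; positivity)]
    congr 1
    · push_cast
      rw [div_inv_eq_mul]
      ring
    · push_cast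
      rfl
  have h3 : -(x : ℂ) ^ 2 / (4 * (((4 * s)⁻¹ : ℝ) : ℂ)) = ((-(x ^ 2 * s) : ℝ) : ℂ) := by
    push_cast
    have : (s : ℂ) ≠ 0 := by exact_mod_cast hs.ne'
    field_simp
  rw [h2, h3, ← Complex.ofReal_exp, ← Complex.ofReal_mul, ← Complex.ofReal_mul]
  congr 1
  have h4 : √(4 * Real.pi * s) ≠ 0 := by
    have := Real.pi_pos
    positivity
  rw [show -((1 + x ^ 2) * s) = -s + -(x ^ 2 * s) by ring, Real.exp_add]
  field_simp

/-- The Fourier transform of the spectral density. -/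
theorem integral_cexp_mul_maternDensity {κ : ℝ} (hκ : 0 < κ) (x : ℝ) :
    ∫ v : ℝ, Complex.exp (Complex.I * (x * v : ℝ)) * (maternDensity κ v : ℝ) =
      (((1 + x ^ 2) ^ (κ / 2))⁻¹ : ℝ) := by
  have hi : Integrable (fun p : ℝ × ℝ => Complex.exp (Complex.I * (x * p.2 : ℝ)) *
      (gammaMixture κ p.1 p.2 : ℝ)) ((volume.restrict (Set.Ioi 0)).prod volume) := by
    refine (integrable_gammaMixture_prod hκ).ofReal.bdd_mul (c := 1)
      (by fun_prop : Continuous fun p : ℝ × ℝ => Complex.exp (Complex.I * (x * p.2 : ℝ))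
        ).aestronglyMeasurable (ae_of_all _ fun p => ?_)
    rw [mul_comm Complex.I, Complex.norm_exp_ofReal_mul_I]
  have e : ∀ v : ℝ, Complex.exp (Complex.I * (x * v : ℝ)) * (maternDensity κ v : ℝ) =
      ((Real.Gamma (κ / 2))⁻¹ : ℝ) * ∫ s in Set.Ioi 0, Complex.exp (Complex.I * (x * v : ℝ)) *
        (gammaMixture κ s v : ℝ) := by
    intro v
    rw [integral_const_mul, maternDensity, integral_complex_ofReal]
    push_cast
    ring
  simp only [e]
  -- After the exchange, the integral over `s` is a Gamma integral with rate `1 + x²`.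
  rw [integral_const_mul, ← integral_integral_swap hi]
  rw [setIntegral_congr_fun measurableSet_Ioi
    (fun s hs => integral_cexp_mul_gammaMixture (κ := κ) hs x), integral_complex_ofReal,
    Real.integral_rpow_mul_exp_neg_mul_Ioi (by positivity) (by positivity), ← Complex.ofReal_mul]
  congr 1
  have := (Real.Gamma_pos_of_pos (show 0 < κ / 2 by positivity)).ne'
  rw [one_div, Real.inv_rpow (by positivity)]
  field_simp

theorem maternDensity_neg (κ v : ℝ) : maternDensity κ (-v) = maternDensity κ v := by
  simp [maternDensity, gammaMixture]

/-- Away from the origin the spectral density is expressed by a Bessel function. -/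
theorem maternDensity_eq {κ : ℝ} {v : ℝ} (hv : v ≠ 0) :
    maternDensity κ v = c₁ κ * besselK ((κ - 1) / 2) |v| * |v| ^ ((κ - 1) / 2) := by
  have hb : 0 < |v| / 2 := by positivity
  -- The substitution `s = |v| τ / 2` makes `s + v² / (4s)` equal to `(|v| / 2)(τ + 1/τ)`, the
  -- exponent of the Bessel integral.
  have h := integral_comp_mul_left_Ioi (fun s => gammaMixture κ s v) 0 hb
  rw [mul_zero, smul_eq_mul] at h
  have e : ∀ τ ∈ Set.Ioi (0 : ℝ), gammaMixture κ (|v| / 2 * τ) v =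
      ((|v| / 2) ^ ((κ - 1) / 2 - 1) * (2 * √Real.pi)⁻¹) * (τ ^ ((κ - 1) / 2 - 1) *
        Real.exp (-(1 / 2) * (τ + 1 / τ) * |v|)) := by
    intro τ hτ
    have hτ : 0 < τ := hτ
    have h0 : 0 < |v| / 2 * τ := by positivity
    have hsq : √(4 * Real.pi * (|v| / 2 * τ)) = 2 * √Real.pi * (|v| / 2 * τ) ^ (1 / 2 : ℝ) :=
      sqrt_four_pi_mul _
    unfold gammaMixture
    rw [hsq, mul_inv, ← Real.rpow_neg h0.le]
    have h1 : (|v| / 2) ^ ((κ - 1) / 2 - 1) * τ ^ ((κ - 1) / 2 - 1) =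
        (|v| / 2 * τ) ^ (κ / 2 - 1) * (|v| / 2 * τ) ^ (-(1 / 2) : ℝ) := by
      rw [← Real.mul_rpow hb.le hτ.le, ← Real.rpow_add h0]
      congr 1
      ring
    have h2 : Real.exp (-(1 / 2) * (τ + 1 / τ) * |v|) =
        Real.exp (-(|v| / 2 * τ)) * Real.exp (-(4 * (|v| / 2 * τ))⁻¹ * v ^ 2) := by
      rw [← Real.exp_add, ← sq_abs v]
      congr 1
      have : |v| ≠ 0 := by positivity
      field_simp
      ring
    rw [h2]
    linear_combination (-(2 * √Real.pi)⁻¹ * Real.exp (-(|v| / 2 * τ)) *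
      Real.exp (-(4 * (|v| / 2 * τ))⁻¹ * v ^ 2)) * h1
  rw [setIntegral_congr_fun measurableSet_Ioi e, integral_const_mul] at h
  have h3 : ∫ s in Set.Ioi 0, gammaMixture κ s v = |v| / 2 *
      ((|v| / 2) ^ ((κ - 1) / 2 - 1) * (2 * √Real.pi)⁻¹ *
        ∫ τ in Set.Ioi 0, τ ^ ((κ - 1) / 2 - 1) * Real.exp (-(1 / 2) * (τ + 1 / τ) * |v|)) := by
    rw [h]
    field_simp
  rw [maternDensity, h3, besselK, c₁]
  have h4 : |v| / 2 * (|v| / 2) ^ ((κ - 1) / 2 - 1) =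
      2 ^ ((1 - κ) / 2) * |v| ^ ((κ - 1) / 2) := by
    rw [Real.rpow_sub_one hb.ne', mul_div_cancel₀ _ hb.ne', Real.div_rpow (abs_nonneg _) (by norm_num),
      show (1 - κ) / 2 = -((κ - 1) / 2) by ring, Real.rpow_neg (by norm_num)]
    field_simp
  rw [← mul_assoc, ← mul_assoc, ← mul_assoc, mul_assoc (Real.Gamma (κ / 2))⁻¹, h4]
  generalize (∫ τ in Set.Ioi 0, τ ^ ((κ - 1) / 2 - 1) *
    Real.exp (-(1 / 2) * (τ + 1 / τ) * |v|)) = J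
  field_simp

/-- Dominated convergence. Near `v ≠ 0` the factor `exp(-u² / (4s))` is `O(s)`, which tames the
singularity `s^((κ-3)/2)` at `s = 0`. At the origin this gain is lost, and the integral diverges for
`κ ≤ 1`. -/
theorem continuousAt_maternDensity {κ : ℝ} (hκ : 0 < κ) {v : ℝ} (hv : v ≠ 0) :
    ContinuousAt (maternDensity κ) v := by
  unfold maternDensity
  refine ContinuousAt.mul continuousAt_const ?_
  set δ := |v| / 2 with hδ
  have hδ0 : 0 < δ := by positivity
  refine continuousAt_of_dominated (bound := fun s => (4 / δ ^ 2 * (2 * √Real.pi)⁻¹) *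
    (Real.exp (-s) * s ^ ((κ + 1) / 2 - 1))) ?_ ?_ ?_ ?_
  · exact Eventually.of_forall fun v => ((measurable_gammaMixture κ).comp
      (measurable_id.prodMk measurable_const)).aestronglyMeasurable
  · have : ∀ᶠ u in 𝓝 v, δ < |u| := by
      refine continuous_abs.continuousAt.eventually_const_lt ?_
      rw [hδ]
      have : 0 < |v| := abs_pos.2 hv
      linarith
    filter_upwards [this] with u hu
    filter_upwards [ae_restrict_mem measurableSet_Ioi] with s hs
    have hs : 0 < s := hs
    rw [Real.norm_of_nonneg (gammaMixture_nonneg hs u)]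
    have hsq : √(4 * Real.pi * s) = 2 * √Real.pi * s ^ (1 / 2 : ℝ) :=
      sqrt_four_pi_mul _
    have h1 : Real.exp (-(4 * s)⁻¹ * u ^ 2) ≤ 4 / δ ^ 2 * s := by
      have hu2 : δ ^ 2 ≤ u ^ 2 := by
        rw [← sq_abs u]
        exact pow_le_pow_left₀ hδ0.le hu.le 2
      have hy : 0 < (4 * s)⁻¹ * δ ^ 2 := by positivity
      calc Real.exp (-(4 * s)⁻¹ * u ^ 2) ≤ Real.exp (-((4 * s)⁻¹ * δ ^ 2)) := by
            refine Real.exp_le_exp.2 ?_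
            have : (4 * s)⁻¹ * δ ^ 2 ≤ (4 * s)⁻¹ * u ^ 2 := by gcongr
            linarith
        -- Here `exp(-y) ≤ 1 / y`, since `y + 1 ≤ exp y`.
        _ ≤ ((4 * s)⁻¹ * δ ^ 2)⁻¹ := by
            rw [Real.exp_neg]
            exact inv_anti₀ hy (by linarith [Real.add_one_le_exp ((4 * s)⁻¹ * δ ^ 2)])
        _ = 4 / δ ^ 2 * s := by field_simp
    have h2 : s ^ ((κ + 1) / 2 - 1) = s ^ (κ / 2 - 1) * s ^ (-(1 / 2) : ℝ) * s := by
      rw [← Real.rpow_add hs, ← Real.rpow_add_one hs.ne']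
      congr 1
      ring
    unfold gammaMixture
    rw [hsq, mul_inv, ← Real.rpow_neg hs.le, h2]
    calc _ ≤ s ^ (κ / 2 - 1) * Real.exp (-s) * ((2 * √Real.pi)⁻¹ * s ^ (-(1 / 2) : ℝ) *
          (4 / δ ^ 2 * s)) := by gcongr
      _ = _ := by ring
  · exact (Real.GammaIntegral_convergent (s := (κ + 1) / 2) (by positivity)).const_mul _
  · refine ae_of_all _ fun s => ?_
    unfold gammaMixture
    fun_prop

end MaternDensity

/-! ### Recovering a density from the Fourier transform. -/

section Density

theorem integrable_cexp_mul {g : ℝ → ℝ} (hg : Integrable g) (t : ℝ) :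
    Integrable (fun v : ℝ => Complex.exp (Complex.I * (t * v : ℝ)) * (g v : ℝ)) := by
  refine hg.ofReal.bdd_mul (c := 1) (by fun_prop : Continuous fun v : ℝ =>
    Complex.exp (Complex.I * (t * v : ℝ))).aestronglyMeasurable (ae_of_all _ fun v => ?_)
  rw [mul_comm Complex.I, Complex.norm_exp_ofReal_mul_I]

/-- The function `f` is not assumed nonnegative. Moving its negative part to the side of `F` leaves
two finite positive measures, to which uniqueness of characteristic functions applies. -/
theorem eq_of_charFun_density {F : Measure ℝ} [IsFiniteMeasure F] {f : ℝ → ℝ}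
    (hf : Integrable f)
    (h : ∀ t : ℝ, ∫ v, Complex.exp (Complex.I * (t * v : ℝ)) ∂F =
      ∫ v : ℝ, Complex.exp (Complex.I * (t * v : ℝ)) * (f v : ℝ)) :
    F + volume.withDensity (fun v => ENNReal.ofReal (-f v)) =
      volume.withDensity (fun v => ENNReal.ofReal (f v)) := by
  have h1 : IsFiniteMeasure (volume.withDensity fun v => ENNReal.ofReal (-f v)) :=
    isFiniteMeasure_withDensity_ofReal hf.neg.2
  have hnm : AEMeasurable (fun v => ENNReal.ofReal (-f v)) :=
    hf.neg.aemeasurable.ennreal_ofReal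
  have h2 : IsFiniteMeasure (volume.withDensity fun v => ENNReal.ofReal (f v)) :=
    isFiniteMeasure_withDensity_ofReal hf.2
  refine Measure.ext_of_charFun ?_
  ext t
  have hE : ∀ (ν : Measure ℝ) [IsFiniteMeasure ν],
      Integrable (fun v : ℝ => Complex.exp (Complex.I * (t * v : ℝ))) ν := by
    intro ν _
    refine Integrable.of_bound (C := 1) (by fun_prop : Continuous fun v : ℝ =>
      Complex.exp (Complex.I * (t * v : ℝ))).aestronglyMeasurable (ae_of_all _ fun v => ?_)
    rw [mul_comm Complex.I, Complex.norm_exp_ofReal_mul_I]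
  have hc : ∀ ν : Measure ℝ, charFun ν t = ∫ v, Complex.exp (Complex.I * (t * v : ℝ)) ∂ν := by
    intro ν
    rw [charFun_apply_real]
    refine integral_congr_ae (ae_of_all _ fun v => ?_)
    simp only
    push_cast
    ring_nf
  rw [hc, hc, integral_add_measure (hE _) (hE _), h,
    integral_withDensity_eq_integral_toReal_smul₀ hnm
      (ae_of_all _ fun _ => ENNReal.ofReal_lt_top),
    integral_withDensity_eq_integral_toReal_smul₀ hf.aemeasurable.ennreal_ofReal
      (ae_of_all _ fun _ => ENNReal.ofReal_lt_top)]
  have hp := integrable_cexp_mul hf.pos_part t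
  have hn := integrable_cexp_mul hf.neg_part t
  rw [← eq_sub_iff_add_eq]
  have e1 : ∀ v, (ENNReal.ofReal (f v)).toReal • Complex.exp (Complex.I * (t * v : ℝ)) =
      Complex.exp (Complex.I * (t * v : ℝ)) * ((max (f v) 0 : ℝ) : ℂ) := by
    intro v
    rw [ENNReal.toReal_ofReal', Complex.real_smul, mul_comm]
  have e2 : ∀ v, (ENNReal.ofReal (-f v)).toReal • Complex.exp (Complex.I * (t * v : ℝ)) =
      Complex.exp (Complex.I * (t * v : ℝ)) * ((max (-f v) 0 : ℝ) : ℂ) := by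
    intro v
    rw [ENNReal.toReal_ofReal', Complex.real_smul, mul_comm]
  simp only [e1, e2]
  rw [← integral_sub hp hn]
  refine integral_congr_ae (ae_of_all _ fun v => ?_)
  simp only
  rw [← mul_sub, ← Complex.ofReal_sub, max_zero_sub_max_neg_zero_eq_self]

/-- A finite measure whose Fourier transform is that of an integrable function has this function
as its density. -/
theorem integral_eq_of_charFun_density {F : Measure ℝ} [IsFiniteMeasure F] {f : ℝ → ℝ}
    (hf : Integrable f)
    (h : ∀ t : ℝ, ∫ v, Complex.exp (Complex.I * (t * v : ℝ)) ∂F =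
      ∫ v : ℝ, Complex.exp (Complex.I * (t * v : ℝ)) * (f v : ℝ))
    {k : ℝ → ℝ} (hk : Measurable k) {C : ℝ} (hkC : ∀ v, |k v| ≤ C) :
    ∫ v, k v ∂F = ∫ v, k v * f v := by
  have h1 : IsFiniteMeasure (volume.withDensity fun v => ENNReal.ofReal (-f v)) :=
    isFiniteMeasure_withDensity_ofReal hf.neg.2
  have hnm : AEMeasurable (fun v => ENNReal.ofReal (-f v)) :=
    hf.neg.aemeasurable.ennreal_ofReal
  have hE : ∀ (ν : Measure ℝ) [IsFiniteMeasure ν], Integrable k ν := fun ν _ =>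
    Integrable.of_bound hk.aestronglyMeasurable C (ae_of_all _ hkC)
  have e : ∫ v, k v ∂(F + _) = ∫ v, k v ∂_ :=
    congrArg (fun ν => ∫ v, k v ∂ν) (eq_of_charFun_density hf h)
  rw [integral_add_measure (hE _) (hE _),
    integral_withDensity_eq_integral_toReal_smul₀ hnm
      (ae_of_all _ fun _ => ENNReal.ofReal_lt_top),
    integral_withDensity_eq_integral_toReal_smul₀ hf.aemeasurable.ennreal_ofReal
      (ae_of_all _ fun _ => ENNReal.ofReal_lt_top)] at e
  have hb : ∀ g : ℝ → ℝ, Integrable g → Integrable (fun v : ℝ => k v * g v) := fun g hg =>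
    hg.bdd_mul (c := C) hk.aestronglyMeasurable (ae_of_all _ hkC)
  rw [eq_sub_of_add_eq e]
  simp only [ENNReal.toReal_ofReal', smul_eq_mul, mul_comm _ (k _)]
  rw [← integral_sub (hb _ hf.pos_part) (hb _ hf.neg_part)]
  refine integral_congr_ae (ae_of_all _ fun v => ?_)
  simp only
  rw [← mul_sub, max_zero_sub_max_neg_zero_eq_self]

end Density

/-! ### Approximate identities. -/

section Concentration

theorem integrable_exp_neg_sq_half : Integrable fun v : ℝ => Real.exp (-v ^ 2 / 2) := by
  have h := integrable_exp_neg_mul_sq (b := 1 / 2) (by norm_num)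
  refine h.congr (ae_of_all _ fun v => ?_)
  simp only
  ring_nf

/-- The Gaussian lower bound makes the mass of `φ` positive, so `φ` can be normalised. The upper
bound gives integrability and decay faster than `1 / |v|`, as the approximate identity requires. -/
theorem tendsto_integral_peak {φ f : ℝ → ℝ} (hφm : Measurable φ) {C : ℝ}
    (hφl : ∀ v, Real.exp (-v ^ 2 / 2) ≤ φ v) (hφu : ∀ v, φ v ≤ C * Real.exp (-v ^ 2 / 2))
    (hf : Integrable f) (hf0 : ContinuousAt f 0) :
    Tendsto (fun c : ℝ => ∫ v, c * φ (c * v) * f v) atTop (𝓝 ((∫ v, φ v) * f 0)) := by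
  have hφ0 : ∀ v, 0 ≤ φ v := fun v => (Real.exp_pos _).le.trans (hφl v)
  have hi : Integrable φ := by
    refine (integrable_exp_neg_sq_half.const_mul C).mono' hφm.aestronglyMeasurable
      (ae_of_all _ fun v => ?_)
    rw [Real.norm_of_nonneg (hφ0 v)]
    exact hφu v
  have hI : 0 < ∫ v, φ v :=
    (integral_exp_pos integrable_exp_neg_sq_half).trans_le
      (integral_mono integrable_exp_neg_sq_half hi hφl)
  have key := tendsto_integral_comp_smul_smul_of_integrable (μ := (volume : Measure ℝ))
    (φ := fun v => (∫ v, φ v)⁻¹ * φ v)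
    (fun v => mul_nonneg (inv_nonneg.2 hI.le) (hφ0 v))
    (by rw [integral_const_mul, inv_mul_cancel₀ hI.ne']) ?_ hf hf0
  · have := key.const_mul (∫ v, φ v)
    refine this.congr fun c => ?_
    rw [← integral_const_mul]
    refine integral_congr_ae (ae_of_all _ fun v => ?_)
    simp only [Module.finrank_self, pow_one, smul_eq_mul]
    field_simp
  · simp only [Module.finrank_self, pow_one]
    have h := tendsto_rpow_abs_mul_exp_neg_mul_sq_cocompact (a := 1 / 2) (by norm_num) 1
    rw [← Metric.cobounded_eq_cocompact] at h
    have h2 := h.const_mul ((∫ v, φ v)⁻¹ * C)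
    rw [mul_zero] at h2
    refine tendsto_of_tendsto_of_tendsto_of_le_of_le tendsto_const_nhds h2
      (fun v => mul_nonneg (norm_nonneg _) (mul_nonneg (inv_nonneg.2 hI.le) (hφ0 v))) fun v => ?_
    simp only [Real.rpow_one, Real.norm_eq_abs]
    have e : Real.exp (-(1 / 2) * v ^ 2) = Real.exp (-v ^ 2 / 2) := by ring_nf
    rw [e]
    calc |v| * ((∫ v, φ v)⁻¹ * φ v) ≤ |v| * ((∫ v, φ v)⁻¹ * (C * Real.exp (-v ^ 2 / 2))) := by
          gcongr
          exact hφu v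
      _ = _ := by ring

/-- Rescaled oscillating Gaussian kernels concentrate at the origin. -/
theorem tendsto_integral_gaussian_cos {q f : ℝ → ℝ} (hq : Measurable q) (hf : Integrable f)
    (hf0 : ContinuousAt f 0) :
    Tendsto (fun c : ℝ => ∫ v, c * (Real.exp (-(c * v) ^ 2 / 2) * Real.cos (q (c * v))) * f v)
      atTop (𝓝 ((∫ v, Real.exp (-v ^ 2 / 2) * Real.cos (q v)) * f 0)) := by
  have hm : Measurable fun v => Real.exp (-v ^ 2 / 2) * Real.cos (q v) := by fun_prop
  have hm2 : Measurable fun v => Real.exp (-v ^ 2 / 2) * (2 + Real.cos (q v)) := by fun_prop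
  have hb : ∀ v, |Real.exp (-v ^ 2 / 2) * Real.cos (q v)| ≤ 1 := by
    intro v
    rw [abs_mul, abs_of_pos (Real.exp_pos _)]
    refine mul_le_one₀ (Real.exp_le_one_iff.2 (by nlinarith [sq_nonneg v])) (abs_nonneg _)
      (Real.abs_cos_le_one _)
  have hb1 : ∀ v : ℝ, |Real.exp (-v ^ 2 / 2)| ≤ 1 := by
    intro v
    rw [abs_of_pos (Real.exp_pos _)]
    exact Real.exp_le_one_iff.2 (by nlinarith [sq_nonneg v])
  -- Peak kernels must be nonnegative, whereas the cosine changes sign. So `2 + cos`, which lies in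
  -- `[1, 3]`, is used, and twice the pure Gaussian is subtracted.
  have h1 := tendsto_integral_peak (C := 3) hm2
    (fun v => le_mul_of_one_le_right (Real.exp_pos _).le (by linarith [Real.neg_one_le_cos (q v)]))
    (fun v => by
      rw [mul_comm]
      exact mul_le_mul_of_nonneg_right (by linarith [Real.cos_le_one (q v)]) (Real.exp_pos _).le)
    hf hf0
  have h2 := tendsto_integral_peak (φ := fun v => Real.exp (-v ^ 2 / 2)) (C := 1) (by fun_prop)
    (fun v => le_rfl) (fun v => by rw [one_mul]) hf hf0
  have h3 := h1.sub (h2.const_mul 2)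
  have hi : Integrable fun v => Real.exp (-v ^ 2 / 2) * Real.cos (q v) := by
    refine integrable_exp_neg_sq_half.mono' hm.aestronglyMeasurable (ae_of_all _ fun v => ?_)
    rw [norm_mul, Real.norm_eq_abs, Real.norm_eq_abs, abs_of_pos (Real.exp_pos _)]
    exact mul_le_of_le_one_right (Real.exp_pos _).le (Real.abs_cos_le_one _)
  have e : (∫ v, Real.exp (-v ^ 2 / 2) * Real.cos (q v)) * f 0 =
      (∫ v, Real.exp (-v ^ 2 / 2) * (2 + Real.cos (q v))) * f 0 -
        2 * ((∫ v, Real.exp (-v ^ 2 / 2)) * f 0) := by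
    have : ∀ v, Real.exp (-v ^ 2 / 2) * (2 + Real.cos (q v)) =
      2 * Real.exp (-v ^ 2 / 2) + Real.exp (-v ^ 2 / 2) * Real.cos (q v) := fun v => by ring
    simp only [this]
    rw [integral_add (integrable_exp_neg_sq_half.const_mul 2) hi, integral_const_mul]
    ring
  rw [e]
  refine h3.congr fun c => ?_
  have i1 : Integrable fun v =>
      c * (Real.exp (-(c * v) ^ 2 / 2) * Real.cos (q (c * v))) * f v := by
    simp only [mul_assoc c]
    refine Integrable.const_mul (hf.bdd_mul (c := 1) ?_ (ae_of_all _ fun v => hb (c * v))) c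
    exact (hm.comp (measurable_const_mul c)).aestronglyMeasurable
  have i2 : Integrable fun v => c * Real.exp (-(c * v) ^ 2 / 2) * f v := by
    simp only [mul_assoc c]
    refine Integrable.const_mul (hf.bdd_mul (c := 1) ?_ (ae_of_all _ fun v => hb1 (c * v))) c
    exact (by fun_prop : Continuous fun v : ℝ => Real.exp (-(c * v) ^ 2 / 2)).aestronglyMeasurable
  rw [← integral_const_mul, sub_eq_iff_eq_add, ← integral_add i1 (i2.const_mul 2)]
  refine integral_congr_ae (ae_of_all _ fun v => ?_)
  simp only
  ring

end Concentration

/-! ### The spectral density of the cyclic covariance. -/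

section SpectralDensity

variable {n : ℕ}

/-- The spectral density of the covariance function `cyclicCov A κ w`. -/
noncomputable def cyclicDensity (A κ w : Fin (n + 1) → ℝ) (v : ℝ) : ℝ :=
  ∑ j, A j / 2 * (maternDensity (κ j) (v + w j) + maternDensity (κ j) (v - w j))

theorem integrable_cyclicDensity {A κ w : Fin (n + 1) → ℝ} (hκ : ∀ j, 0 < κ j) :
    Integrable (cyclicDensity A κ w) :=
  integrable_finsetSum _ fun j _ => (((integrable_maternDensity (hκ j)).comp_add_right (w j)).add
    ((integrable_maternDensity (hκ j)).comp_sub_right (w j))).const_mul _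

theorem integral_cexp_mul_maternDensity_shift {κ : ℝ} (hκ : 0 < κ) (x a : ℝ) :
    ∫ v : ℝ, Complex.exp (Complex.I * (x * v : ℝ)) * (maternDensity κ (v - a) : ℝ) =
      Complex.exp (Complex.I * (x * a : ℝ)) * (((1 + x ^ 2) ^ (κ / 2))⁻¹ : ℝ) := by
  rw [← integral_add_right_eq_self _ a, ← integral_cexp_mul_maternDensity hκ x,
    ← integral_const_mul]
  refine integral_congr_ae (ae_of_all _ fun v => ?_)
  simp only [add_sub_cancel_right]
  rw [← mul_assoc, ← Complex.exp_add]
  push_cast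
  ring_nf

/-- Shifting a density by `±w_j` multiplies its Fourier transform by `exp(±i x w_j)`; the half sum
is the cosine. -/
theorem integral_cexp_mul_cyclicDensity {A κ w : Fin (n + 1) → ℝ} (hκ : ∀ j, 0 < κ j) (x : ℝ) :
    ∫ v : ℝ, Complex.exp (Complex.I * (x * v : ℝ)) * (cyclicDensity A κ w v : ℝ) =
      (cyclicCov A κ w x : ℝ) := by
  have e : ∀ v : ℝ, Complex.exp (Complex.I * (x * v : ℝ)) * (cyclicDensity A κ w v : ℝ) =
      ∑ j, (A j / 2 : ℂ) * (Complex.exp (Complex.I * (x * v : ℝ)) *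
          (maternDensity (κ j) (v - -w j) : ℝ) +
        Complex.exp (Complex.I * (x * v : ℝ)) * (maternDensity (κ j) (v - w j) : ℝ)) := by
    intro v
    rw [cyclicDensity, Complex.ofReal_sum, Finset.mul_sum]
    refine Finset.sum_congr rfl fun j _ => ?_
    rw [sub_neg_eq_add]
    push_cast
    ring
  have hi : ∀ j a, Integrable fun v : ℝ => Complex.exp (Complex.I * (x * v : ℝ)) *
      (maternDensity (κ j) (v - a) : ℝ) := fun j a =>
    integrable_cexp_mul ((integrable_maternDensity (hκ j)).comp_sub_right a) x
  have hs : ∀ j a b, Integrable fun v : ℝ => (A j / 2 : ℂ) * (Complex.exp (Complex.I * (x * v : ℝ)) *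
      (maternDensity (κ j) (v - a) : ℝ) + Complex.exp (Complex.I * (x * v : ℝ)) *
      (maternDensity (κ j) (v - b) : ℝ)) := fun j a b => ((hi j a).add (hi j b)).const_mul _
  simp only [e]
  rw [integral_finsetSum _ fun j _ => hs j _ _, cyclicCov,
    Complex.ofReal_sum]
  refine Finset.sum_congr rfl fun j _ => ?_
  rw [integral_const_mul, integral_add (hi j _) (hi j _),
    integral_cexp_mul_maternDensity_shift (hκ j), integral_cexp_mul_maternDensity_shift (hκ j),
    ← add_mul]
  have hc : Complex.exp (Complex.I * (x * -w j : ℝ)) + Complex.exp (Complex.I * (x * w j : ℝ)) =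
      2 * (Real.cos (w j * x) : ℝ) := by
    rw [Complex.ofReal_cos, Complex.two_cos]
    push_cast
    ring_nf
  rw [hc]
  push_cast
  ring

/-- The vanishing `A 0` removes the component with zero frequency, and evenness merges the two
shifts of every other one. -/
theorem cyclicDensity_zero {A κ w : Fin (n + 1) → ℝ} (hA : A 0 = 0)
    (hw : ∀ j, j ≠ 0 → w j ≠ 0) : cyclicDensity A κ w 0 = specConst A κ w := by
  rw [cyclicDensity, Fin.sum_univ_succ, hA, specConst]
  simp only [zero_div, zero_mul, zero_add, zero_sub, maternDensity_neg]
  refine Finset.sum_congr rfl fun j _ => ?_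
  rw [maternDensity_eq (hw _ (Fin.succ_ne_zero j))]
  ring

theorem continuousAt_cyclicDensity {A κ w : Fin (n + 1) → ℝ} (hκ : ∀ j, 0 < κ j) (hA : A 0 = 0)
    (hw : ∀ j, j ≠ 0 → w j ≠ 0) : ContinuousAt (cyclicDensity A κ w) 0 := by
  unfold cyclicDensity
  refine tendsto_finsetSum _ fun j _ => ?_
  by_cases hj : j = 0
  · simp [hj, hA]
  · refine ContinuousAt.mul continuousAt_const (ContinuousAt.add ?_ ?_)
    · exact ContinuousAt.comp (g := maternDensity (κ j))
        (continuousAt_maternDensity (hκ j) (by simpa using hw j hj)) (by fun_prop)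
    · exact ContinuousAt.comp (g := maternDensity (κ j))
        (continuousAt_maternDensity (hκ j) (by simpa using hw j hj)) (by fun_prop)

end SpectralDensity

/-! ### Laws of Gaussian vectors through covariances. -/

section WeakConvergence

variable {Ω Ω' : Type*} [MeasurableSpace Ω] [MeasurableSpace Ω'] {P : Measure Ω}
  {P' : Measure Ω'} [IsProbabilityMeasure P] [IsProbabilityMeasure P'] {F G : Measure ℝ}
  {Z : Set ℝ → Ω → ℂ} {W : Set ℝ → Ω' → ℂ}

/-- Centred Gaussian vectors converge in distribution if their covariances converge. -/
theorem tendstoInDistribution_of_tendsto_integral_mul (hZ : IsSymmGaussianRandomMeasure P F Z)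
    (hW : IsSymmGaussianRandomMeasure P' G W) {ι : Type*} {l : Filter ι}
    [l.IsCountablyGenerated] {N : ℕ} {X : ι → Fin N → Ω → ℝ} {Y : Fin N → Ω' → ℝ}
    (hX : ∀ i k, MemGaussianSpace P F Z (X i k)) (hY : ∀ k, MemGaussianSpace P' G W (Y k))
    (h : ∀ j k, Tendsto (fun i => ∫ ω, X i j ω * X i k ω ∂P) l (𝓝 (∫ ω, Y j ω * Y k ω ∂P'))) :
    TendstoInDistribution (fun i ω k => X i k ω) l (fun ω k => Y k ω) (fun _ => P) P' := by
  have hXm : ∀ i, AEMeasurable (fun ω k => X i k ω) P := fun i =>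
    aemeasurable_pi_lambda _ fun k => (hX i k).1.aestronglyMeasurable.aemeasurable
  have hYm : AEMeasurable (fun ω k => Y k ω) P' :=
    aemeasurable_pi_lambda _ fun k => (hY k).1.aestronglyMeasurable.aemeasurable
  -- Lévy's continuity theorem with `charFun` needs an inner product, so the vectors pass to
  -- Euclidean space and return by continuous mapping.
  let T : (Fin N → ℝ) →L[ℝ] EuclideanSpace ℝ (Fin N) :=
    (EuclideanSpace.equiv (Fin N) ℝ).symm.toContinuousLinearMap
  have hT : Measurable T := T.continuous.measurable
  have key : TendstoInDistribution (fun i ω => T fun k => X i k ω) l (fun ω => T fun k => Y k ω)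
      (fun _ => P) P' := by
    refine ⟨fun i => hT.comp_aemeasurable (hXm i), hT.comp_aemeasurable hYm, ?_⟩
    -- Sequences suffice because `l` is countably generated.
    refine tendsto_of_seq_tendsto fun s hs => ?_
    refine ProbabilityMeasure.tendsto_of_tendsto_charFun fun t => ?_
    change Tendsto (fun n => charFun (P.map (fun ω => T fun k => X (s n) k ω)) t) atTop
      (𝓝 (charFun (P'.map (fun ω => T fun k => Y k ω)) t))
    have e : ∀ i, P.map (fun ω => T fun k => X i k ω) =
        (P.map (fun ω k => X i k ω)).map T := fun i =>
      (AEMeasurable.map_map_of_aemeasurable hT.aemeasurable (hXm i)).symm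
    have e' : P'.map (fun ω => T fun k => Y k ω) = (P'.map (fun ω k => Y k ω)).map T :=
      (AEMeasurable.map_map_of_aemeasurable hT.aemeasurable hYm).symm
    simp only [e, e', charFun_eq_charFunDual_toDualMap, charFunDual_map]
    simp only [MemGaussianSpace.charFunDual_map hZ (hX _),
      MemGaussianSpace.charFunDual_map hW hY]
    refine (Complex.continuous_exp.tendsto _).comp (Tendsto.div_const (Tendsto.neg ?_) 2)
    refine (Complex.continuous_ofReal.tendsto _).comp ?_
    exact tendsto_finsetSum _ fun j _ => tendsto_finsetSum _ fun k _ =>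
      ((h j k).comp hs).const_mul _
  exact key.continuous_comp (g := EuclideanSpace.equiv (Fin N) ℝ)
    (EuclideanSpace.equiv (Fin N) ℝ).continuous

/-- The law of a centred Gaussian vector is determined by its covariances. -/
theorem map_eq_of_integral_mul_eq (hZ : IsSymmGaussianRandomMeasure P F Z) {ι : Type*} [Fintype ι]
    {X Y : ι → Ω → ℝ} (hX : ∀ i, MemGaussianSpace P F Z (X i))
    (hY : ∀ i, MemGaussianSpace P F Z (Y i))
    (h : ∀ i j, ∫ ω, X i ω * X j ω ∂P = ∫ ω, Y i ω * Y j ω ∂P) :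
    P.map (fun ω i => X i ω) = P.map (fun ω i => Y i ω) := by
  classical
  have hXm : AEMeasurable (fun ω i => X i ω) P :=
    aemeasurable_pi_lambda _ fun k => (hX k).1.aestronglyMeasurable.aemeasurable
  have hYm : AEMeasurable (fun ω i => Y i ω) P :=
    aemeasurable_pi_lambda _ fun k => (hY k).1.aestronglyMeasurable.aemeasurable
  have := Measure.isProbabilityMeasure_map hXm
  have := Measure.isProbabilityMeasure_map hYm
  refine Measure.ext_of_charFunDual ?_
  ext L
  rw [MemGaussianSpace.charFunDual_map hZ hX, MemGaussianSpace.charFunDual_map hZ hY]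
  simp only [h]

end WeakConvergence

/-! ### Covariances of real stochastic integrals and the Fourier transform of `F`. -/

section Fields

variable {Ω : Type*} [MeasurableSpace Ω] {P : Measure Ω} {F : Measure ℝ} {Z : Set ℝ → Ω → ℂ}

/-- The covariance of two real stochastic integrals with given amplitudes and phases. -/
theorem integral_mul_eq_integral_cos (hZ : IsSymmGaussianRandomMeasure P F Z)
    {θ θ' ρ ρ' : ℝ → ℝ}
    (hφ : MemLp (fun v => Complex.exp (Complex.I * (θ v : ℝ)) * (ρ v : ℂ)) 2 F)
    (hψ : MemLp (fun v => Complex.exp (Complex.I * (θ' v : ℝ)) * (ρ' v : ℂ)) 2 F)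
    {c d : ℝ} {X Y : Ω → ℝ}
    (hX : (fun ω => (X ω : ℂ)) =ᵐ[P] fun ω => (c : ℂ) *
      stochInt P F Z (fun v => Complex.exp (Complex.I * (θ v : ℝ)) * (ρ v : ℂ)) ω)
    (hY : (fun ω => (Y ω : ℂ)) =ᵐ[P] fun ω => (d : ℂ) *
      stochInt P F Z (fun v => Complex.exp (Complex.I * (θ' v : ℝ)) * (ρ' v : ℂ)) ω) :
    ∫ ω, X ω * Y ω ∂P = c * d * ∫ v, ρ v * ρ' v * Real.cos (θ v - θ' v) ∂F := by
  have h := integral_mul_of_ae_eq hZ hφ hψ hX hY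
  have hi := hφ.integrable_mul hψ.star
  have hr := integral_re hi
  have h2 := congrArg Complex.re h
  rw [Complex.ofReal_re, ← Complex.ofReal_mul, Complex.re_ofReal_mul] at h2
  rw [h2]
  congr 1
  refine hr.symm.trans ?_
  refine integral_congr_ae (ae_of_all _ fun v => ?_)
  simp only [Pi.mul_apply, Pi.star_apply, RCLike.star_def, map_mul, Complex.conj_ofReal,
    ← Complex.exp_conj, Complex.conj_I, RCLike.re_eq_complex_re]
  have e : Complex.exp (Complex.I * (θ v : ℝ)) * (ρ v : ℂ) *
      (Complex.exp (-Complex.I * (θ' v : ℝ)) * (ρ' v : ℂ)) =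
      ((ρ v * ρ' v : ℝ) : ℂ) * Complex.exp (((θ v - θ' v : ℝ) : ℂ) * Complex.I) := by
    rw [show ((θ v - θ' v : ℝ) : ℂ) * Complex.I = Complex.I * (θ v : ℝ) + -Complex.I * (θ' v : ℝ) by
      push_cast; ring, Complex.exp_add]
    push_cast
    ring
  rw [e, Complex.re_ofReal_mul, Complex.exp_ofReal_mul_I_re]

theorem memLp_exp_I_mul [IsFiniteMeasure F] {θ : ℝ → ℝ} (hθ : Measurable θ) :
    MemLp (fun v => Complex.exp (Complex.I * (θ v : ℝ))) 2 F := by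
  refine MemLp.of_bound (C := 1) ?_ (ae_of_all _ fun v => ?_)
  · exact Measurable.aestronglyMeasurable (by fun_prop)
  · rw [mul_comm, Complex.norm_exp_ofReal_mul_I]

theorem integral_mul_eq_integral_cos_phase [IsFiniteMeasure F]
    (hZ : IsSymmGaussianRandomMeasure P F Z)
    {θ θ' : ℝ → ℝ} (hθ : Measurable θ) (hθ' : Measurable θ') {c d : ℝ} {X Y : Ω → ℝ}
    (hX : (fun ω => (X ω : ℂ)) =ᵐ[P] fun ω => (c : ℂ) *
      stochInt P F Z (fun v => Complex.exp (Complex.I * (θ v : ℝ))) ω)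
    (hY : (fun ω => (Y ω : ℂ)) =ᵐ[P] fun ω => (d : ℂ) *
      stochInt P F Z (fun v => Complex.exp (Complex.I * (θ' v : ℝ))) ω) :
    ∫ ω, X ω * Y ω ∂P = c * d * ∫ v, Real.cos (θ v - θ' v) ∂F := by
  have e : ∀ θ : ℝ → ℝ, (fun v => Complex.exp (Complex.I * (θ v : ℝ))) =
      fun v => Complex.exp (Complex.I * (θ v : ℝ)) * ((1 : ℝ) : ℂ) := by
    intro θ
    simp
  have hφ := memLp_exp_I_mul (F := F) hθ
  have hψ := memLp_exp_I_mul (F := F) hθ'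
  rw [e] at hφ hψ hX hY
  simpa using integral_mul_eq_integral_cos (ρ := fun _ => 1) (ρ' := fun _ => 1) hZ hφ hψ hX hY

variable [IsProbabilityMeasure P]

/-- The Fourier transform of the control measure is the covariance function. -/
theorem integral_cexp_eq_cyclicCov [IsFiniteMeasure F] (hZ : IsSymmGaussianRandomMeasure P F Z)
    {M : ℝ → ℝ} {η : ℝ → Ω → ℝ} (hη : IsInitialCondition P F Z M η) {n : ℕ}
    {A κ w : Fin (n + 1) → ℝ} (hcov : HasCyclicCov P η A κ w) (x : ℝ) :
    ∫ v, Complex.exp (Complex.I * (x * v : ℝ)) ∂F = (cyclicCov A κ w x : ℝ) := by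
  have hφ : ∀ y : ℝ, MemLp (fun v => Complex.exp (Complex.I * (v * y : ℝ))) 2 F := fun y =>
    memLp_exp_I_mul (θ := fun v => v * y) (by fun_prop)
  have hX : ∀ y, (fun ω => ((η y ω - M y : ℝ) : ℂ)) =ᵐ[P] fun ω => ((1 : ℝ) : ℂ) *
      stochInt P F Z (fun v => Complex.exp (Complex.I * (v * y : ℝ))) ω := by
    intro y
    filter_upwards [hη y] with ω hω
    rw [Complex.ofReal_sub, hω]
    simp
  have hG := fun y => memGaussianSpace_of_ae_eq hZ (hφ y) (hX y)
  have h1 := hcov.cov_eq 0 x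
  rw [zero_add] at h1
  -- Covariances ignore the deterministic mean, and the centred values are pure stochastic
  -- integrals.
  have h2 : cov[η 0, η x; P] = ∫ ω, (η x ω - M x) * (η 0 ω - M 0) ∂P := by
    rw [← (hG x).covariance_eq hZ (hG 0), covariance_comm]
    rw [covariance_sub_const_left, covariance_sub_const_right]
    · have := (hG 0).1.integrable (by norm_num)
      exact (this.add (integrable_const (M 0))).congr (ae_of_all _ fun ω => by simp)
    · have := (hG x).1.integrable (by norm_num)
      exact (this.add (integrable_const (M x))).congr (ae_of_all _ fun ω => by simp)
  rw [← h1, h2, integral_mul_of_ae_eq hZ (hφ x) (hφ 0) (hX x) (hX 0)]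
  simp [mul_comm]

end Fields

/-! ### The rescaled, smoothed solution and its covariance. -/

theorem measurable_phase (μ : ℝ) (m : ℕ) (t x : ℝ) : Measurable (phase μ m t x) := by
  unfold phase
  fun_prop

/-- The reason for the scaling: time by `ε^(-m/2)` and space by `ε^(-1/2)` together amount to
dilating the frequency. -/
theorem phase_rescaled (μ : ℝ) (m : ℕ) {ε : ℝ} (hε : 0 < ε) (t y v : ℝ) :
    phase μ m (t / √(ε ^ m)) (y / √ε) v = phase μ m t y ((√ε)⁻¹ * v) := by
  have h : √(ε ^ m) = √ε ^ m := by
    rw [Real.sqrt_eq_iff_mul_self_eq (by positivity) (by positivity), ← mul_pow,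
      Real.mul_self_sqrt hε.le]
  rw [phase, phase, h, mul_pow, inv_pow]
  ring

section SmoothedField

variable {Ω : Type*} [MeasurableSpace Ω] {P : Measure Ω} [IsProbabilityMeasure P]
  {F : Measure ℝ} [IsFiniteMeasure F] {Z : Set ℝ → Ω → ℂ} {M : ℝ → ℝ} {μ : ℝ} {m : ℕ}
  {D : ℝ → ℝ → ℝ} {u : ℝ → ℝ → Ω → ℝ}

/-- The random part of the rescaled solution field. -/
noncomputable def rescaledNoise (m : ℕ) (u : ℝ → ℝ → Ω → ℝ) (D : ℝ → ℝ → ℝ) (ε t y : ℝ) (ω : Ω) : ℝ :=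
  u (t / √(ε ^ m)) (y / √ε) ω - D (t / √(ε ^ m)) (y / √ε)

omit [IsProbabilityMeasure P] [IsFiniteMeasure F] in
theorem rescaledNoise_ae_eq (hu : IsSolutionField P F Z M μ m D u) {ε t : ℝ} (hε : 0 < ε)
    (ht : 0 < t) (y : ℝ) :
    (fun ω => (rescaledNoise m u D ε t y ω : ℂ)) =ᵐ[P] fun ω => (((2 * Real.pi)⁻¹ : ℝ) : ℂ) *
      stochInt P F Z (fun v => Complex.exp (Complex.I *
        (phase μ m t y ((√ε)⁻¹ * v) : ℝ))) ω := by
  filter_upwards [hu.eq (t / √(ε ^ m)) (by positivity) (y / √ε)] with ω hω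
  simp only [phase_rescaled μ m hε] at hω
  rw [rescaledNoise, Complex.ofReal_sub, hω]
  push_cast
  ring

omit [IsProbabilityMeasure P] in
theorem memGaussianSpace_rescaledNoise (hZ : IsSymmGaussianRandomMeasure P F Z)
    (hu : IsSolutionField P F Z M μ m D u) {ε t : ℝ} (hε : 0 < ε) (ht : 0 < t) (y : ℝ) :
    MemGaussianSpace P F Z (rescaledNoise m u D ε t y) :=
  memGaussianSpace_of_ae_eq hZ (memLp_exp_I_mul ((measurable_phase μ m t y).comp
    (measurable_const_mul _))) (rescaledNoise_ae_eq hu hε ht y)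

omit [IsProbabilityMeasure P] in
theorem integral_rescaledNoise_mul (hZ : IsSymmGaussianRandomMeasure P F Z)
    (hu : IsSolutionField P F Z M μ m D u) {ε t t' : ℝ} (hε : 0 < ε) (ht : 0 < t) (ht' : 0 < t')
    (y y' : ℝ) :
    ∫ ω, rescaledNoise m u D ε t y ω * rescaledNoise m u D ε t' y' ω ∂P =
      (2 * Real.pi)⁻¹ * (2 * Real.pi)⁻¹ *
        ∫ v, Real.cos (phase μ m t y ((√ε)⁻¹ * v) - phase μ m t' y' ((√ε)⁻¹ * v)) ∂F :=
  integral_mul_eq_integral_cos_phase hZ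
    ((measurable_phase μ m t y).comp (measurable_const_mul _))
    ((measurable_phase μ m t' y').comp (measurable_const_mul _))
    (rescaledNoise_ae_eq hu hε ht y) (rescaledNoise_ae_eq hu hε ht' y')

omit [IsProbabilityMeasure P] in
-- The bound is uniform in `y`, as the exchange of spatial average and expectation demands.
theorem integral_rescaledNoise_sq_le (hZ : IsSymmGaussianRandomMeasure P F Z)
    (hu : IsSolutionField P F Z M μ m D u) {ε t : ℝ} (hε : 0 < ε) (ht : 0 < t) (y : ℝ) :
    ∫ ω, rescaledNoise m u D ε t y ω ^ 2 ∂P ≤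
      (2 * Real.pi)⁻¹ * (2 * Real.pi)⁻¹ * F.real Set.univ := by
  simp only [pow_two]
  rw [integral_rescaledNoise_mul hZ hu hε ht ht]
  simp

theorem integrable_gaussMeasure_iff (x : ℝ) {f : ℝ → ℝ} :
    Integrable f (gaussMeasure x) ↔ Integrable fun y => gaussKernel y x * f y := by
  rw [gaussMeasure, integrable_withDensity_iff_integrable_smul'
    (measurable_gaussKernel x).ennreal_ofReal (ae_of_all _ fun _ => ENNReal.ofReal_lt_top)]
  simp [(gaussKernel_pos _ x).le]

omit [IsProbabilityMeasure P] [IsFiniteMeasure F] in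
theorem aestronglyMeasurable_rescaledNoise (hu : IsSolutionField P F Z M μ m D u)
    (hD : ∀ t ε x : ℝ, 0 < t → 0 < ε → Integrable (fun x₁ => gaussKernel x₁ x * D t (x₁ / √ε)))
    {ε t : ℝ} (hε : 0 < ε) (ht : 0 < t) (x : ℝ) :
    AEStronglyMeasurable (fun p : ℝ × Ω => rescaledNoise m u D ε t p.1 p.2)
      ((gaussMeasure x).prod P) := by
  have ht' : 0 < t / √(ε ^ m) := by positivity
  have h1 : Measurable fun p : ℝ × Ω => u (t / √(ε ^ m)) (p.1 / √ε) p.2 :=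
    (hu.measurable _ ht').comp (by fun_prop : Measurable fun p : ℝ × Ω => (p.1 / √ε, p.2))
  have h2 := ((integrable_gaussMeasure_iff x).2 (hD _ ε x ht' hε)).aestronglyMeasurable
  exact h1.aestronglyMeasurable.sub h2.comp_fst

/-- The random part averages to mean zero, so the expectation of the average is the average of `D`;
centring removes exactly this. -/
theorem smoothedField_ae_eq (hZ : IsSymmGaussianRandomMeasure P F Z)
    (hu : IsSolutionField P F Z M μ m D u)
    (hD : ∀ t ε x : ℝ, 0 < t → 0 < ε → Integrable (fun x₁ => gaussKernel x₁ x * D t (x₁ / √ε)))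
    {ε t : ℝ} (hε : 0 < ε) (ht : 0 < t) (x : ℝ) :
    (fun ω => ε ^ (-(1 / 4) : ℝ) * ∫ y, rescaledNoise m u D ε t y ω ∂gaussMeasure x) =ᵐ[P]
      smoothedField P m u ε t x := by
  have ht' : 0 < t / √(ε ^ m) := by positivity
  have hm := aestronglyMeasurable_rescaledNoise hu hD hε ht x
  have hG := memGaussianSpace_rescaledNoise hZ hu hε ht
  have hB := integral_rescaledNoise_sq_le hZ hu hε ht
  have hDi := (integrable_gaussMeasure_iff x).2 (hD _ ε x ht' hε)
  have h1 : ∀ᵐ ω ∂P, ∫ y, gaussKernel y x * u (t / √(ε ^ m)) (y / √ε) ω =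
      (∫ y, rescaledNoise m u D ε t y ω ∂gaussMeasure x) +
        ∫ y, D (t / √(ε ^ m)) (y / √ε) ∂gaussMeasure x := by
    filter_upwards [ae_memLp_two_section hm (fun y => (hG y).1) hB] with ω hω
    rw [← integral_add (hω.integrable (by norm_num)) hDi, integral_gaussMeasure]
    simp [rescaledNoise]
  have hY := memGaussianSpace_integral hm hG hB
  have h2 : ∫ ω, (∫ y, gaussKernel y x * u (t / √(ε ^ m)) (y / √ε) ω) ∂P =
      ∫ y, D (t / √(ε ^ m)) (y / √ε) ∂gaussMeasure x := by
    rw [integral_congr_ae h1, integral_add (hY.1.integrable (by norm_num)) (integrable_const _),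
      hY.integral_eq_zero hZ]
    simp
  filter_upwards [h1] with ω hω
  rw [smoothedField, h2, hω]
  ring

theorem memGaussianSpace_smoothedField (hZ : IsSymmGaussianRandomMeasure P F Z)
    (hu : IsSolutionField P F Z M μ m D u)
    (hD : ∀ t ε x : ℝ, 0 < t → 0 < ε → Integrable (fun x₁ => gaussKernel x₁ x * D t (x₁ / √ε)))
    {ε t : ℝ} (hε : 0 < ε) (ht : 0 < t) (x : ℝ) :
    MemGaussianSpace P F Z (smoothedField P m u ε t x) :=
  ((memGaussianSpace_integral (aestronglyMeasurable_rescaledNoise hu hD hε ht x)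
    (memGaussianSpace_rescaledNoise hZ hu hε ht)
    (integral_rescaledNoise_sq_le hZ hu hε ht)).const_mul _).congr
    (smoothedField_ae_eq hZ hu hD hε ht x)

/-- The covariance of the smoothed field as a rescaled Gaussian average of `F`. -/
theorem integral_smoothedField_mul (hZ : IsSymmGaussianRandomMeasure P F Z)
    (hu : IsSolutionField P F Z M μ m D u)
    (hD : ∀ t ε x : ℝ, 0 < t → 0 < ε → Integrable (fun x₁ => gaussKernel x₁ x * D t (x₁ / √ε)))
    {ε t t' : ℝ} (hε : 0 < ε) (ht : 0 < t) (ht' : 0 < t') (x x' : ℝ) :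
    ∫ ω, smoothedField P m u ε t x ω * smoothedField P m u ε t' x' ω ∂P =
      (4 * Real.pi)⁻¹ * ∫ v, (√ε)⁻¹ * (Real.exp (-((√ε)⁻¹ * v) ^ 2 / 2) *
        Real.cos (phase μ m (t - t') (x - x') ((√ε)⁻¹ * v))) ∂F := by
  have hm := aestronglyMeasurable_rescaledNoise hu hD hε ht x
  have hG := memGaussianSpace_rescaledNoise hZ hu hε ht
  have hB := integral_rescaledNoise_sq_le hZ hu hε ht
  have hm' := aestronglyMeasurable_rescaledNoise hu hD hε ht' x'
  have hG' := memGaussianSpace_rescaledNoise hZ hu hε ht'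
  have hB' := integral_rescaledNoise_sq_le hZ hu hε ht'
  have hY' := memGaussianSpace_integral hm' hG' hB'
  set c := (√ε)⁻¹ with hc
  set s := μ * (-1) ^ ((m - 1) / 2) with hs
  have hph : ∀ t y v, phase μ m t y (c * v) = c * v * y + s * (c * v) ^ m * t := fun t y v => rfl
  -- The two averages are evaluated one at a time; each contributes a factor `√π exp(-(cv)²/4)`.
  have e1 : ∀ y, ∫ ω, rescaledNoise m u D ε t y ω *
      (∫ y', rescaledNoise m u D ε t' y' ω ∂gaussMeasure x') ∂P =
      ∫ v, √Real.pi * Real.exp (-(c * v) ^ 2 / 4) * ((2 * Real.pi)⁻¹ * (2 * Real.pi)⁻¹) *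
        Real.cos (c * v * y + (s * (c * v) ^ m * t - c * v * x' - s * (c * v) ^ m * t')) ∂F := by
    intro y
    simp only [mul_comm (rescaledNoise m u D ε t y _)]
    rw [integral_integral_field_mul hm' (fun y => (hG' y).1) hB' (hG y).1]
    simp only [integral_rescaledNoise_mul hZ hu hε ht' ht, ← hc, hph]
    have := integral_gaussMeasure_integral_cos (F := F) (k := fun _ => (2 * Real.pi)⁻¹ * (2 * Real.pi)⁻¹)
      (a := fun v => c * v) (b := fun v => s * (c * v) ^ m * t' - c * v * y - s * (c * v) ^ m * t)
      measurable_const (fun v => le_rfl) (by fun_prop) (by fun_prop) x'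
    simp only [integral_const_mul] at this
    refine Eq.trans ?_ (this.trans ?_)
    · rw [integral_const_mul]
      congr 1
      refine integral_congr_ae (ae_of_all _ fun y' => integral_congr_ae (ae_of_all _ fun v => ?_))
      simp only
      congr 1
      ring
    · refine integral_congr_ae (ae_of_all _ fun v => ?_)
      simp only
      rw [← Real.cos_neg]
      ring_nf
  have e2 : ∫ ω, (∫ y, rescaledNoise m u D ε t y ω ∂gaussMeasure x) *
      (∫ y', rescaledNoise m u D ε t' y' ω ∂gaussMeasure x') ∂P =
      ∫ v, (4 * Real.pi)⁻¹ * (Real.exp (-(c * v) ^ 2 / 2) *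
        Real.cos (phase μ m (t - t') (x - x') (c * v))) ∂F := by
    rw [integral_integral_field_mul hm (fun y => (hG y).1) hB hY'.1]
    simp only [e1]
    rw [integral_gaussMeasure_integral_cos (F := F)
      (k := fun v => √Real.pi * Real.exp (-(c * v) ^ 2 / 4) * ((2 * Real.pi)⁻¹ * (2 * Real.pi)⁻¹))
      (a := fun v => c * v)
      (b := fun v => s * (c * v) ^ m * t - c * v * x' - s * (c * v) ^ m * t')
      (C := √Real.pi * ((2 * Real.pi)⁻¹ * (2 * Real.pi)⁻¹))
      (by fun_prop) (fun v => ?_) (by fun_prop) (by fun_prop) x]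
    · refine integral_congr_ae (ae_of_all _ fun v => ?_)
      simp only
      have h1 : Real.exp (-(c * v) ^ 2 / 2) =
          Real.exp (-(c * v) ^ 2 / 4) * Real.exp (-(c * v) ^ 2 / 4) := by
        rw [← Real.exp_add]
        ring_nf
      have h2 : √Real.pi * √Real.pi = Real.pi := Real.mul_self_sqrt Real.pi_pos.le
      -- Two kernel masses `√π` and two normalisations `1 / (2π)` leave `1 / (4π)`.
      have h3 : √Real.pi * √Real.pi * ((2 * Real.pi)⁻¹ * (2 * Real.pi)⁻¹) = (4 * Real.pi)⁻¹ := by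
        rw [h2]
        field_simp
        norm_num
      rw [h1, ← h3, hph]
      ring_nf
    · rw [abs_of_nonneg (by positivity)]
      have : Real.exp (-(c * v) ^ 2 / 4) ≤ 1 :=
        Real.exp_le_one_iff.2 (by nlinarith [sq_nonneg (c * v)])
      refine mul_le_mul_of_nonneg_right ?_ (by positivity)
      exact mul_le_of_le_one_right (Real.sqrt_nonneg _) this
  have e3 : ∫ ω, smoothedField P m u ε t x ω * smoothedField P m u ε t' x' ω ∂P =
      ε ^ (-(1 / 4) : ℝ) * ε ^ (-(1 / 4) : ℝ) *
      ∫ ω, (∫ y, rescaledNoise m u D ε t y ω ∂gaussMeasure x) *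
      (∫ y', rescaledNoise m u D ε t' y' ω ∂gaussMeasure x') ∂P := by
    rw [← integral_const_mul]
    refine integral_congr_ae ?_
    filter_upwards [smoothedField_ae_eq hZ hu hD hε ht x,
      smoothedField_ae_eq hZ hu hD hε ht' x'] with ω h1 h2
    rw [← h1, ← h2]
    ring
  -- The normalisation `ε^(-1/4)` enters twice and gives exactly the factor `c` of an approximate
  -- identity at scale `1 / c`.
  have h4 : ε ^ (-(1 / 4) : ℝ) * ε ^ (-(1 / 4) : ℝ) = c := by
    rw [← Real.rpow_add hε, hc, Real.sqrt_eq_rpow, ← Real.rpow_neg hε.le]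
    norm_num
  rw [e3, e2, h4, ← integral_const_mul, ← integral_const_mul]
  refine integral_congr_ae (ae_of_all _ fun v => ?_)
  simp only
  ring

end SmoothedField

/-! ### Passage to the limit for the control measure. -/

theorem tendsto_inv_sqrt_atTop :
    Tendsto (fun ε : Set.Ioi (0 : ℝ) => (√(ε : ℝ))⁻¹) (comap Subtype.val (𝓝 (0 : ℝ))) atTop := by
  refine tendsto_inv_nhdsGT_zero.comp (tendsto_nhdsWithin_iff.2 ⟨?_, ?_⟩)
  · have h : Tendsto (fun x : ℝ => √x) (𝓝 0) (𝓝 0) := by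
      have := Real.continuous_sqrt.tendsto 0
      rwa [Real.sqrt_zero] at this
    exact h.comp tendsto_comap
  · exact Eventually.of_forall fun ε => Real.sqrt_pos.2 ε.2

section ControlMeasure

variable {F : Measure ℝ} [IsFiniteMeasure F] {f : ℝ → ℝ}

/-- If `F` has the density `f`, continuous at the origin, then the rescaled Gaussian averages of `F`
converge. -/
theorem tendsto_integral_gaussian_cos_measure (hf : Integrable f) (hf0 : ContinuousAt f 0)
    (h : ∀ t : ℝ, ∫ v, Complex.exp (Complex.I * (t * v : ℝ)) ∂F =
      ∫ v : ℝ, Complex.exp (Complex.I * (t * v : ℝ)) * (f v : ℝ)) {q : ℝ → ℝ}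
    (hq : Measurable q) :
    Tendsto (fun c : ℝ => ∫ v, c * (Real.exp (-(c * v) ^ 2 / 2) * Real.cos (q (c * v))) ∂F) atTop
      (𝓝 ((∫ v, Real.exp (-v ^ 2 / 2) * Real.cos (q v)) * f 0)) := by
  refine (tendsto_integral_gaussian_cos hq hf hf0).congr fun c => ?_
  rw [integral_eq_of_charFun_density hf h (C := |c|) (by fun_prop) fun v => ?_]
  rw [abs_mul, abs_mul, abs_of_pos (Real.exp_pos _)]
  refine mul_le_of_le_one_right (abs_nonneg _) (mul_le_one₀
    (Real.exp_le_one_iff.2 (by nlinarith [sq_nonneg (c * v)])) (abs_nonneg _)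
      (Real.abs_cos_le_one _))

/-- The coefficients of the density may be negative, but its value at zero, times a positive mass,
is a limit of integrals of nonnegative kernels against the positive measure `F`. -/
theorem density_zero_nonneg (hf : Integrable f) (hf0 : ContinuousAt f 0)
    (h : ∀ t : ℝ, ∫ v, Complex.exp (Complex.I * (t * v : ℝ)) ∂F =
      ∫ v : ℝ, Complex.exp (Complex.I * (t * v : ℝ)) * (f v : ℝ)) : 0 ≤ f 0 := by
  have h1 := tendsto_integral_gaussian_cos_measure hf hf0 h (q := fun _ => 0) measurable_const
  simp only [Real.cos_zero, mul_one] at h1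
  have h2 : 0 ≤ (∫ v : ℝ, Real.exp (-v ^ 2 / 2)) * f 0 := by
    refine ge_of_tendsto h1 ?_
    filter_upwards [eventually_ge_atTop 0] with c hc
    exact integral_nonneg fun v => mul_nonneg hc (Real.exp_pos _).le
  exact nonneg_of_mul_nonneg_right h2 (integral_exp_pos integrable_exp_neg_sq_half)

end ControlMeasure

/-! ### The covariance of the limit field. -/

section LimitField

variable {Ω : Type*} [MeasurableSpace Ω] {P : Measure Ω} {W : Set ℝ → Ω → ℂ} {C μ : ℝ} {m : ℕ}
  {U₀ : ℝ → ℝ → Ω → ℝ}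

theorem limitField_ae_eq (hU₀ : IsLimitField P W C μ m U₀) {t : ℝ} (ht : 0 < t) (x : ℝ) :
    (fun ω => (U₀ t x ω : ℂ)) =ᵐ[P] fun ω => ((1 / (2 * √Real.pi) * √C : ℝ) : ℂ) *
      stochInt P volume W (fun v => Complex.exp (Complex.I * (phase μ m t x v : ℝ)) *
        (Real.exp (-v ^ 2 / 4) : ℂ)) ω := by
  have h := hU₀ t ht x
  have e : ∀ v : ℝ, Complex.exp (-(v : ℂ) ^ 2 / 4) = ((Real.exp (-v ^ 2 / 4) : ℝ) : ℂ) := by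
    intro v
    push_cast
    rfl
  simpa only [e] using h

theorem memLp_exp_I_mul_gaussian {θ : ℝ → ℝ} (hθ : Measurable θ) :
    MemLp (fun v => Complex.exp (Complex.I * (θ v : ℝ)) * (Real.exp (-v ^ 2 / 4) : ℂ)) 2
      volume := by
  have hm : Measurable fun v : ℝ => Complex.exp (Complex.I * (θ v : ℝ)) *
      ((Real.exp (-v ^ 2 / 4) : ℝ) : ℂ) := by fun_prop
  rw [memLp_two_iff_integrable_sq_norm hm.aestronglyMeasurable]
  refine integrable_exp_neg_sq_half.congr (ae_of_all _ fun v => ?_)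
  simp only
  rw [norm_mul, mul_comm Complex.I, Complex.norm_exp_ofReal_mul_I, one_mul, Complex.norm_real,
    Real.norm_eq_abs, abs_of_pos (Real.exp_pos _), ← Real.exp_nat_mul]
  ring_nf

theorem memGaussianSpace_limitField (hW : IsSymmGaussianRandomMeasure P volume W)
    (hU₀ : IsLimitField P W C μ m U₀) {t : ℝ} (ht : 0 < t) (x : ℝ) :
    MemGaussianSpace P volume W (U₀ t x) :=
  memGaussianSpace_of_ae_eq hW (memLp_exp_I_mul_gaussian (measurable_phase μ m t x))
    (limitField_ae_eq hU₀ ht x)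

theorem phase_sub (μ : ℝ) (m : ℕ) (t x t' x' v : ℝ) :
    phase μ m t x v - phase μ m t' x' v = phase μ m (t - t') (x - x') v := by
  unfold phase
  ring

/-- The isometry for `W`; the phases subtract to a phase in the differences of the arguments.
Nonnegativity of `C` ensures that `√C` squares to `C`. -/
theorem integral_limitField_mul (hC : 0 ≤ C) (hW : IsSymmGaussianRandomMeasure P volume W)
    (hU₀ : IsLimitField P W C μ m U₀) {t t' : ℝ} (ht : 0 < t) (ht' : 0 < t') (x x' : ℝ) :
    ∫ ω, U₀ t x ω * U₀ t' x' ω ∂P = (4 * Real.pi)⁻¹ *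
      ((∫ v, Real.exp (-v ^ 2 / 2) * Real.cos (phase μ m (t - t') (x - x') v)) * C) := by
  rw [integral_mul_eq_integral_cos hW (memLp_exp_I_mul_gaussian (measurable_phase μ m t x))
    (memLp_exp_I_mul_gaussian (measurable_phase μ m t' x')) (limitField_ae_eq hU₀ ht x)
    (limitField_ae_eq hU₀ ht' x')]
  have e : ∀ v : ℝ, Real.exp (-v ^ 2 / 4) * Real.exp (-v ^ 2 / 4) = Real.exp (-v ^ 2 / 2) := by
    intro v
    rw [← Real.exp_add]
    ring_nf
  simp only [e, phase_sub]
  have h : 1 / (2 * √Real.pi) * √C * (1 / (2 * √Real.pi) * √C) = (4 * Real.pi)⁻¹ * C := by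
    have h1 : √Real.pi * √Real.pi = Real.pi := Real.mul_self_sqrt Real.pi_pos.le
    have h2 : √C * √C = C := Real.mul_self_sqrt hC
    calc _ = (√C * √C) * (4 * (√Real.pi * √Real.pi))⁻¹ := by field_simp; ring
      _ = _ := by rw [h1, h2]; ring
  rw [h]
  ring

end LimitField

/-! ### Proof of the theorem. -/

theorem theorem4p1
    {Ω : Type*} [MeasurableSpace Ω] (P : Measure Ω) [IsProbabilityMeasure P]
    {Ω' : Type*} [MeasurableSpace Ω'] (P' : Measure Ω') [IsProbabilityMeasure P']
    -- the equation
    (m k : ℕ) (hk : 1 ≤ k) (hm : m = 2 * k + 1) (μ : ℝ) (hμ : μ = 1 ∨ μ = -1)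
    -- the initial condition
    (F : Measure ℝ) [IsFiniteMeasure F] (Z : Set ℝ → Ω → ℂ)
    (hZ : IsSymmGaussianRandomMeasure P F Z)
    (M : ℝ → ℝ) (η : ℝ → Ω → ℝ) (hη : IsInitialCondition P F Z M η)
    {n : ℕ} (A κ w : Fin (n + 1) → ℝ) (hcov : HasCyclicCov P η A κ w) (hA : A 0 = 0)
    -- the solution; the kernel averages of its mean are well defined
    (D : ℝ → ℝ → ℝ) (u : ℝ → ℝ → Ω → ℝ) (hu : IsSolutionField P F Z M μ m D u)
    (hD : ∀ t ε x : ℝ, 0 < t → 0 < ε →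
      Integrable (fun x₁ => gaussKernel x₁ x * D t (x₁ / √ε)))
    -- the limit field, driven by white noise
    (W : Set ℝ → Ω' → ℂ) (hW : IsSymmGaussianRandomMeasure P' volume W)
    (U₀ : ℝ → ℝ → Ω' → ℝ) (hU₀ : IsLimitField P' W (specConst A κ w) μ m U₀) :
    -- weak convergence of the finite-dimensional distributions as `ε → 0+`
    (∀ (N : ℕ) (t x : Fin N → ℝ), (∀ i, 0 < t i) →
      TendstoInDistribution
        (fun (ε : Set.Ioi (0 : ℝ)) (ω : Ω) (i : Fin N) => smoothedField P m u ε (t i) (x i) ω)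
        (comap Subtype.val (𝓝 (0 : ℝ)))
        (fun (ω : Ω') (i : Fin N) => U₀ (t i) (x i) ω) (fun _ => P) P') ∧
    -- the limit is a zero-mean Gaussian field
    IsGaussianProcess (fun (p : {p : ℝ × ℝ // 0 < p.1}) (ω : Ω') => U₀ p.1.1 p.1.2 ω) P' ∧
    (∀ t x : ℝ, 0 < t → ∫ ω, U₀ t x ω ∂P' = 0) ∧
    -- its covariance function
    (∀ t x t' x' : ℝ, 0 < t → 0 < t' →
      cov[U₀ t x, U₀ t' x'; P'] =
        (∑ j : Fin n, c₁ (κ j.succ) * A j.succ * besselK ((κ j.succ - 1) / 2) |w j.succ| /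
          (4 * Real.pi * |w j.succ| ^ ((1 - κ j.succ) / 2))) *
        ∫ v : ℝ, Real.cos (v * (x - x') + μ * (-1) ^ ((m - 1) / 2) * (t - t') * v ^ m) *
          Real.exp (-v ^ 2 / 2)) ∧
    -- stationarity in space and time
    (∀ (N : ℕ) (t x : Fin N → ℝ) (h y : ℝ), (∀ i, 0 < t i) → (∀ i, 0 < t i + h) →
      P'.map (fun (ω : Ω') (i : Fin N) => U₀ (t i + h) (x i + y) ω) =
        P'.map (fun (ω : Ω') (i : Fin N) => U₀ (t i) (x i) ω)) := by
  have hκ : ∀ j, 0 < κ j := fun j => (hcov.κ_mem j).1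
  have hf : Integrable (cyclicDensity A κ w) := integrable_cyclicDensity hκ
  have hf0 := continuousAt_cyclicDensity hκ hA hcov.w_ne_zero
  have hC0 := cyclicDensity_zero (κ := κ) hA hcov.w_ne_zero
  have hF : ∀ s : ℝ, ∫ v, Complex.exp (Complex.I * (s * v : ℝ)) ∂F =
      ∫ v : ℝ, Complex.exp (Complex.I * (s * v : ℝ)) * (cyclicDensity A κ w v : ℝ) := fun s => by
    rw [integral_cexp_eq_cyclicCov hZ hη hcov, integral_cexp_mul_cyclicDensity hκ]
  have hC : 0 ≤ specConst A κ w := hC0 ▸ density_zero_nonneg hf hf0 hF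
  have hU := fun (t : ℝ) (ht : 0 < t) (x : ℝ) => memGaussianSpace_limitField hW hU₀ ht x
  refine ⟨fun N t x ht => ?_, ⟨fun I => ?_⟩, fun t x ht => (hU t ht x).integral_eq_zero hW,
    fun t x t' x' ht ht' => ?_, fun N t x h y ht hth => ?_⟩
  · refine tendstoInDistribution_of_tendsto_integral_mul hZ hW
      (fun ε i => memGaussianSpace_smoothedField hZ hu hD ε.2 (ht i) (x i))
      (fun i => hU _ (ht i) (x i)) fun i j => ?_
    rw [integral_limitField_mul hC hW hU₀ (ht i) (ht j), ← hC0]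
    simp only [fun ε : Set.Ioi (0 : ℝ) =>
      integral_smoothedField_mul hZ hu hD ε.2 (ht i) (ht j) (x i) (x j)]
    exact ((tendsto_integral_gaussian_cos_measure hf hf0 hF (measurable_phase μ m _ _)).comp
      tendsto_inv_sqrt_atTop).const_mul _
  · classical
    exact MemGaussianSpace.hasGaussianLaw_pi hW fun i : I => hU i.1.1.1 i.1.2 i.1.1.2
  · rw [(hU t ht x).covariance_eq hW (hU t' ht' x'), integral_limitField_mul hC hW hU₀ ht ht',
      specConst]
    have h1 : (∑ j : Fin n, c₁ (κ j.succ) * A j.succ * besselK ((κ j.succ - 1) / 2) |w j.succ| /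
          (4 * Real.pi * |w j.succ| ^ ((1 - κ j.succ) / 2))) =
        (4 * Real.pi)⁻¹ * ∑ j : Fin n, c₁ (κ j.succ) * A j.succ *
          besselK ((κ j.succ - 1) / 2) |w j.succ| * |w j.succ| ^ ((κ j.succ - 1) / 2) := by
      rw [Finset.mul_sum]
      refine Finset.sum_congr rfl fun j _ => ?_
      rw [show (κ j.succ - 1) / 2 = -((1 - κ j.succ) / 2) by ring, Real.rpow_neg (abs_nonneg _)]
      rw [div_eq_mul_inv, mul_inv]
      ring
    have h2 : ∫ v, Real.exp (-v ^ 2 / 2) * Real.cos (phase μ m (t - t') (x - x') v) =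
        ∫ v : ℝ, Real.cos (v * (x - x') + μ * (-1) ^ ((m - 1) / 2) * (t - t') * v ^ m) *
          Real.exp (-v ^ 2 / 2) := by
      refine integral_congr_ae (ae_of_all _ fun v => ?_)
      simp only [phase]
      ring_nf
    rw [h1, h2]
    ring
  · refine map_eq_of_integral_mul_eq hW (fun i => hU _ (hth i) _) (fun i => hU _ (ht i) _)
      fun i j => ?_
    rw [integral_limitField_mul hC hW hU₀ (hth i) (hth j),
      integral_limitField_mul hC hW hU₀ (ht i) (ht j)]
    -- A common shift cancels in all differences, so the covariances agree.
    simp only [add_sub_add_right_eq_sub]
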